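/- Let $K$ be a field and let $U_1,U_2,V_1,V_2$ be pairwise disjoint nonempty finite sets of vertices with $|U_i|=n_i$ and $|V_i|=m_i$ for $i=1,2$. Put $V=V_1\sqcup V_2$ and let $G=K_{U_1,V}\cup K_{U_2,V_2}$ be the bipartite graph on $U_1\sqcup U_2\sqcup V_1\sqcup V_2$ whose edges are the pairs $\{u,v\}$ with $u\in U_1,\ v\in V$ or with $u\in U_2,\ v\in V_2$. Let $R$ be the standard graded polynomial ring over $K$ whose variables are the vertices of $G$, and let $J_G\subset R$ be the cover ideal of $G$, generated by the monomials $\prod_{x\in C}x$ where $C$ runs over the vertex covers of $G$. Then for every integer $s\ge 1$ the minimal graded free resolution of $R/J_G^s$ over $R$ has the form \[ 0\longrightarrow R^{\binom{s}{2}}\longrightarrow R^{2\binom{s+1}{2}}\longrightarrow R^{\binom{s+2}{2}}\longrightarrow R\longrightarrow 0 \] (degree shifts omitted). Moreover, the Castelnuovo--Mumford regularity $\operatorname{reg}(J_G^s)=\max\{j-i : \operatorname{Tor}_i^R(J_G^s,K)_j\ne 0\}$ is the maximum of the following integers: \[ \begin{array}{ll} (s-j)n_1+(s-i)n_2+jm_1+im_2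 & \text{for } 0\le j\le i\le s,\\ (s-j)n_1+(s-i)n_2+(j+1)m_1+im_2-1 & \text{for } 0\le j<i\le s,\\ (s-j)n_1+(s-i+1)n_2+jm_1+im_2-1 & \text{for } 0\le j<i\le s,\\ (s-j)n_1+(s-i)n_2+(j+1)m_1+(i+1)m_2-2 & \text{for } 0\le j<i<s. \end{array} \] -/

import Mathlib

open scoped TensorProduct

noncomputable section

namespace CoverIdealPowers

/-- The complete bipartite graph `K_{A,B}` with parts `A` and `B` (disjoint finite sets of vertices),
as a graph on the ambient vertex type `W`. -/
def completeBipartiteOn {W : Type*} (A B : Finset W) : SimpleGraph W :=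
  SimpleGraph.fromRel fun a b => a ∈ A ∧ b ∈ B

/-- The cover ideal `J_G` in `K[x_v : v ∈ W]`: it is generated by the squarefree monomials
`∏ v ∈ C, x_v`, where `C` runs over the vertex covers of `G`. -/
def coverIdeal (K : Type*) [Field K] {W : Type*} (G : SimpleGraph W) :
    Ideal (MvPolynomial W K) :=
  Ideal.span {p | ∃ C : Finset W, G.IsVertexCover (C : Set W) ∧
    p = ∏ v ∈ C, (MvPolynomial.X v : MvPolynomial W K)}

section Graded

variable (K : Type*) [Field K] (W : Type*)

/-- The component of degree `d` of the graded free module `⨁ b, R(-a b)`, with `R = K[x_v : v ∈ W]`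
standard graded: the `b`-th basis vector has degree `a b`. -/
def freeDeg {ι : Type*} (a : ι → ℤ) (d : ℤ) : AddSubgroup (ι → MvPolynomial W K) where
  carrier := {f | ∀ b, ∀ u ∈ (f b).support, (u.degree : ℤ) + a b = d}
  zero_mem' := by intro b u hu; simp at hu
  add_mem' := by
    classical
    intro f g hf hg b u hu
    rcases Finset.mem_union.1 (MvPolynomial.support_add hu) with h | h
    · exact hf b u h
    · exact hg b u h
  neg_mem' := by
    intro f hf b u hu
    exact hf b u (by simpa using hu)

/-- The component of degree `d` of the standard graded ring `R = K[x_v : v ∈ W]`: the homogeneous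
polynomials of degree `d` (only `0` if `d < 0`). -/
def ringDeg (d : ℤ) : AddSubgroup (MvPolynomial W K) where
  carrier := {p | ∀ u ∈ p.support, (u.degree : ℤ) = d}
  zero_mem' := by intro u hu; simp at hu
  add_mem' := by
    classical
    intro f g hf hg u hu
    rcases Finset.mem_union.1 (MvPolynomial.support_add hu) with h | h
    · exact hf u h
    · exact hg u h
  neg_mem' := by
    intro f hf u hu
    exact hf u (by simpa using hu)

/-- The homogeneous maximal ideal `(x_v : v ∈ W)`. -/
def irrelevant : Ideal (MvPolynomial W K) :=
  Ideal.span (Set.range MvPolynomial.X)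

/-- The residue field `K = R / (x_v : v ∈ W)` as an `R`-module. -/
abbrev Residue : Type _ := MvPolynomial W K ⧸ irrelevant K W

end Graded

variable {K : Type*} [Field K] {W : Type*}

/-- The grading of an ideal `I`, induced from `R`. -/
def idealDeg (I : Ideal (MvPolynomial W K)) (d : ℤ) : AddSubgroup I :=
  (ringDeg K W d).comap I.subtype.toAddMonoidHom

/-- The grading of the quotient `R / I`, induced from `R`. -/
def quotientDeg (I : Ideal (MvPolynomial W K)) (d : ℤ) : AddSubgroup (MvPolynomial W K ⧸ I) :=
  (ringDeg K W d).map (Ideal.Quotient.mk I).toAddMonoidHom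

/-- A graded free resolution `⋯ → F₂ → F₁ → F₀ → M → 0` of the graded module `M = ⨁ d, ℳ d` over
`R = K[x_v : v ∈ W]`, by graded free modules `Fᵢ = ⨁ b, R(-shift i b)` of finite rank `rank i`; the
maps are homogeneous of degree `0`. -/
structure GradedFreeResolution (K : Type*) [Field K] (W : Type*)
    {M : Type*} [AddCommGroup M] [Module (MvPolynomial W K) M] (ℳ : ℤ → AddSubgroup M) where
  rank : ℕ → ℕ
  shift : ∀ i, Fin (rank i) → ℤ
  d : ∀ i, (Fin (rank (i + 1)) → MvPolynomial W K) →ₗ[MvPolynomial W K]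
    (Fin (rank i) → MvPolynomial W K)
  aug : (Fin (rank 0) → MvPolynomial W K) →ₗ[MvPolynomial W K] M
  d_homogeneous : ∀ i e, ∀ f ∈ freeDeg K W (shift (i + 1)) e, d i f ∈ freeDeg K W (shift i) e
  aug_homogeneous : ∀ e, ∀ f ∈ freeDeg K W (shift 0) e, aug f ∈ ℳ e
  aug_surjective : Function.Surjective aug
  exact_aug : Function.Exact (d 0) aug
  exact_d : ∀ i, Function.Exact (d (i + 1)) (d i)

namespace GradedFreeResolution

variable {M : Type*} [AddCommGroup M] [Module (MvPolynomial W K) M] {ℳ : ℤ → AddSubgroup M}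
  (F : GradedFreeResolution K W ℳ)

/-- A resolution is minimal if each differential maps `Fᵢ₊₁` into `𝔪 Fᵢ`, where `𝔪` is the
homogeneous maximal ideal. -/
def IsMinimal : Prop :=
  ∀ i, LinearMap.range (F.d i) ≤
    irrelevant K W • (⊤ : Submodule (MvPolynomial W K) (Fin (F.rank i) → MvPolynomial W K))

/-- The module `Fᵢ ⊗ K` in the complex `F ⊗ K`. -/
abbrev Fiber (i : ℕ) : Type _ :=
  (Fin (F.rank i) → MvPolynomial W K) ⊗[MvPolynomial W K] Residue K W

/-- The differential `Fᵢ₊₁ ⊗ K → Fᵢ ⊗ K`. -/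
def fiberD (i : ℕ) : F.Fiber (i + 1) →ₗ[MvPolynomial W K] F.Fiber i :=
  (F.d i).rTensor (Residue K W)

/-- The component of degree `j` of `Fᵢ ⊗ K`, where `K` is concentrated in degree `0`. -/
def fiberDeg (i : ℕ) (j : ℤ) : AddSubgroup (F.Fiber i) :=
  (freeDeg K W (F.shift i) j).map
    ((TensorProduct.mk (MvPolynomial W K) (Fin (F.rank i) → MvPolynomial W K)
      (Residue K W)).flip 1).toAddMonoidHom

/-- The cycles of `F ⊗ K` in homological degree `i`. -/
def cycles : (i : ℕ) → Submodule (MvPolynomial W K) (F.Fiber i)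
  | 0 => ⊤
  | i + 1 => LinearMap.ker (F.fiberD i)

/-- `Tor_i(M, K)_j`, the component of degree `j` of the homology (cycles modulo boundaries) of `F ⊗ K`
in homological degree `i`. It is realized as the image in `(Fᵢ ⊗ K) / boundaries` of the cycles of
degree `j`. -/
def torDeg (i : ℕ) (j : ℤ) :
    AddSubgroup (F.Fiber i ⧸ LinearMap.range (F.fiberD i)) :=
  (F.fiberDeg i j ⊓ (F.cycles i).toAddSubgroup).map
    (Submodule.mkQ (LinearMap.range (F.fiberD i))).toAddMonoidHom

end GradedFreeResolution

/-- `r` is the Castelnuovo–Mumford regularity `max {j - i : Tor_i(M, K)_j ≠ 0}` of the graded module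
`M = ⨁ d, ℳ d`. The module `Tor_i(M, K)` may be computed from any graded free resolution, of which
there is one. -/
def HasRegularity (K : Type*) [Field K] (W : Type*)
    {M : Type*} [AddCommGroup M] [Module (MvPolynomial W K) M] (ℳ : ℤ → AddSubgroup M) (r : ℤ) : Prop :=
  Nonempty (GradedFreeResolution K W ℳ) ∧
    ∀ F : GradedFreeResolution K W ℳ,
      IsGreatest {q : ℤ | ∃ (i : ℕ) (j : ℤ), F.torDeg i j ≠ ⊥ ∧ q = j - i} r

end CoverIdealPowers

end

/-!
Write `a₁, a₂, b₁, b₂` for the products of the variables in `U₁, U₂, V₁, V₂`. The minimal vertex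
covers of `G` are `U₁ ∪ U₂`, `U₁ ∪ V₂` and `V₁ ∪ V₂`, so the cover ideal is
`(a₁ a₂, a₁ b₂, b₁ b₂)`, and its `s`-th power is generated by the monomials
`a₁ ^ (s - j) * a₂ ^ (s - i) * b₁ ^ j * b₂ ^ i` with `j ≤ i ≤ s` (`coverIdeal_eq_span`,
`span_pow_eq_span_vertexLabel`).

Place such a monomial at the lattice point `(i, j)`. The points, unit segments and unit squares of
the staircase `j ≤ i ≤ s` form a cell complex which, labelled by least common multiples, supports a
complex of free modules. It is the strand of degree `s` of the Koszul complex on the two equations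
`b₂ T₁ = a₂ T₂` and `b₁ T₂ = a₁ T₃` of the Rees algebra. Its exactness (`cellMap_exact`) holds in
every domain in which `a₁, a₂, b₁, b₂` satisfy some regularity conditions, and is shown by removing
the rows `j = t` of a cycle one after the other, from the top. For a relation between the labels, a
power of `a₁` cancels, and then only the top row is left modulo `a₁`; it is a relation between the
monomials `a₂ ^ (s - i) * b₂ ^ i`, and all of these come from the obvious ones
(`exists_syzygy_of_sum_mem`). The regularity conditions hold for products of disjoint
sets of variables (`isRegularQuadruple_prodX`).

The entries of the differentials are `± a₁, ± a₂, ± b₁, ± b₂`, and the labels themselves at the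
augmentation, so the resolution is minimal. Any two graded free resolutions of a graded module are
related by homogeneous chain maps, which are inverse to each other up to homotopy
(`nonempty_comparison`, `exists_homotopy`). Hence the ranks of a minimal resolution are the numbers
of cells (`IsMinimal.rank_eq`), and whatever resolution is used to compute it, `Tor_i(-, K)_j` is
nonzero exactly when some cell of dimension `i` has a label of degree `j` (`torDeg_ne_bot_iff`,
`IsMinimal.torDeg_ne_bot_iff`). Points, segments and squares give the four families of integers.
-/

noncomputable section

namespace CoverIdealPowers

/-! ### Homogeneous components -/

section Components

variable {K : Type*} [Field K] {W : Type*}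

theorem mem_freeDeg {ι : Type*} {a : ι → ℤ} {d : ℤ} {f : ι → MvPolynomial W K} :
    f ∈ freeDeg K W a d ↔ ∀ b, f b ∈ ringDeg K W (d - a b) := by
  refine forall_congr' fun b => forall₂_congr fun u _ => ?_
  exact eq_sub_iff_add_eq.symm

theorem mul_mem_ringDeg {p q : MvPolynomial W K} {d e : ℤ} (hp : p ∈ ringDeg K W d)
    (hq : q ∈ ringDeg K W e) : p * q ∈ ringDeg K W (d + e) := by
  classical
  intro u hu
  obtain ⟨v, hv, w, hw, rfl⟩ := Finset.mem_add.1 (MvPolynomial.support_mul p q hu)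
  rw [← hp v hv, ← hq w hw, map_add]
  push_cast
  rfl

theorem monomial_mem_ringDeg (u : W →₀ ℕ) (c : K) :
    MvPolynomial.monomial u c ∈ ringDeg K W u.degree := by
  classical
  intro v hv
  rw [Finset.mem_singleton.1 (MvPolynomial.support_monomial_subset hv)]

/-- The homogeneous component of degree `d` of a polynomial, where `d` is an integer. -/
def ringProj (d : ℤ) : MvPolynomial W K →ₗ[K] MvPolynomial W K :=
  if 0 ≤ d then MvPolynomial.homogeneousComponent d.toNat else 0

theorem coeff_ringProj (d : ℤ) (p : MvPolynomial W K) (u : W →₀ ℕ) :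
    (ringProj d p).coeff u = if (u.degree : ℤ) = d then p.coeff u else 0 := by
  unfold ringProj
  split_ifs with h1 h2 h2
  · rw [MvPolynomial.coeff_homogeneousComponent, if_pos (by omega)]
  · rw [MvPolynomial.coeff_homogeneousComponent, if_neg (by omega)]
  · omega
  · simp

theorem ringProj_mem (d : ℤ) (p : MvPolynomial W K) : ringProj d p ∈ ringDeg K W d := by
  intro u hu
  by_contra h
  rw [MvPolynomial.mem_support_iff, coeff_ringProj, if_neg h] at hu
  exact hu rfl

theorem ringProj_of_mem {d : ℤ} {p : MvPolynomial W K} (hp : p ∈ ringDeg K W d) :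
    ringProj d p = p := by
  ext u
  rw [coeff_ringProj]
  split_ifs with h
  · rfl
  · by_contra h'
    exact h (hp u (MvPolynomial.mem_support_iff.2 (Ne.symm h')))

theorem ringProj_of_mem_ne {d e : ℤ} {p : MvPolynomial W K} (hp : p ∈ ringDeg K W d)
    (h : e ≠ d) : ringProj e p = 0 := by
  ext u
  rw [coeff_ringProj]
  split_ifs with h1
  · by_contra h'
    exact h (h1.symm.trans (hp u (MvPolynomial.mem_support_iff.2 h')))
  · simp

/-- The homogeneous component of degree `d` of an element of the graded free module
`⨁ b, R(-a b)`. -/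
def freeProj {ι : Type*} (a : ι → ℤ) (d : ℤ) :
    (ι → MvPolynomial W K) →ₗ[K] (ι → MvPolynomial W K) :=
  LinearMap.pi fun b => ringProj (d - a b) ∘ₗ LinearMap.proj b

theorem freeProj_mem {ι : Type*} (a : ι → ℤ) (d : ℤ) (f : ι → MvPolynomial W K) :
    freeProj a d f ∈ freeDeg K W a d :=
  mem_freeDeg.2 fun _ => ringProj_mem _ _

/-- The family `ℳ` of subgroups admits projections onto its members. This is the part of
"`M` is the direct sum of the `ℳ d`" that lifting along homogeneous maps uses. -/
def HasProjections {M : Type*} [AddCommGroup M] (ℳ : ℤ → AddSubgroup M) : Prop :=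
  ∃ π : ℤ → M →+ M, ∀ e, ∀ m ∈ ℳ e, π e m = m ∧ ∀ e', e' ≠ e → π e' m = 0

theorem hasProjections_freeDeg {ι : Type*} (a : ι → ℤ) : HasProjections (freeDeg K W a) := by
  refine ⟨fun e => (freeProj a e).toAddMonoidHom, fun e m hm => ⟨?_, fun e' he' => ?_⟩⟩
  · funext b
    exact ringProj_of_mem (mem_freeDeg.1 hm b)
  · funext b
    exact ringProj_of_mem_ne (mem_freeDeg.1 hm b) (by omega)

theorem single_mem_freeDeg {ι : Type*} [DecidableEq ι] {a : ι → ℤ} {d : ℤ} {b : ι}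
    {p : MvPolynomial W K} (hp : p ∈ ringDeg K W (d - a b)) :
    Pi.single b p ∈ freeDeg K W a d := by
  refine mem_freeDeg.2 fun b' => ?_
  rcases eq_or_ne b' b with rfl | h
  · simpa using hp
  · rw [Pi.single_eq_of_ne h]
    exact zero_mem _

/-- A finite free module is additively generated by its homogeneous elements. -/
theorem freeDeg_induction {ι : Type*} [Finite ι] (a : ι → ℤ)
    {P : (ι → MvPolynomial W K) → Prop} (h0 : P 0) (hadd : ∀ f g, P f → P g → P (f + g))
    (hdeg : ∀ e, ∀ f ∈ freeDeg K W a e, P f) (f : ι → MvPolynomial W K) : P f := by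
  classical
  cases nonempty_fintype ι
  have key : ∀ (b : ι) (p : MvPolynomial W K), P (Pi.single b p) := by
    intro b p
    induction p using MvPolynomial.induction_on' with
    | monomial u c =>
      refine hdeg (u.degree + a b) _ (single_mem_freeDeg ?_)
      rw [add_sub_cancel_right]
      exact monomial_mem_ringDeg u c
    | add p q hp hq =>
      rw [Pi.single_add]
      exact hadd _ _ hp hq
  rw [← Finset.univ_sum_single f]
  exact Finset.sum_induction _ P hadd h0 fun b _ => key b _

/-- A homogeneous element in the image of a homogeneous map is the image of a homogeneous
element. -/
theorem exists_homogeneous_preimage {ι N : Type*} [Finite ι] [AddCommGroup N] {a : ι → ℤ}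
    {𝒩 : ℤ → AddSubgroup N} (h𝒩 : HasProjections 𝒩) (φ : (ι → MvPolynomial W K) →+ N)
    (hφ : ∀ e, ∀ f ∈ freeDeg K W a e, φ f ∈ 𝒩 e) {e : ℤ} (x : ι → MvPolynomial W K)
    (hx : φ x ∈ 𝒩 e) : ∃ x' ∈ freeDeg K W a e, φ x' = φ x := by
  obtain ⟨π, hπ⟩ := h𝒩
  obtain ⟨ρ, hρ⟩ := hasProjections_freeDeg (K := K) (W := W) a
  refine ⟨freeProj a e x, freeProj_mem a e x, ?_⟩
  have key : φ (freeProj a e x) = π e (φ x) := by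
    clear hx
    induction x using freeDeg_induction a with
    | h0 => simp
    | hadd f g hf hg => simp [hf, hg]
    | hdeg e' f hf =>
      rcases eq_or_ne e e' with rfl | h
      · rw [(hπ e _ (hφ e f hf)).1]
        congr 1
        funext b
        exact ringProj_of_mem (mem_freeDeg.1 hf b)
      · rw [(hπ e' _ (hφ e' f hf)).2 e h]
        have : freeProj a e f = 0 := by
          funext b
          exact ringProj_of_mem_ne (mem_freeDeg.1 hf b) (by omega)
        rw [this, map_zero]
  rw [key, (hπ e _ hx).1]

/-- Projectivity of graded free modules: a homogeneous map into the range of a homogeneous map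
lifts to a homogeneous map. -/
theorem exists_homogeneous_lift {ι ι' N : Type*} [Finite ι] [Finite ι'] [AddCommGroup N]
    [Module (MvPolynomial W K) N] {a : ι → ℤ} {a' : ι' → ℤ} {𝒩 : ℤ → AddSubgroup N}
    (h𝒩 : HasProjections 𝒩)
    (φ : (ι → MvPolynomial W K) →ₗ[MvPolynomial W K] N)
    (hφ : ∀ e, ∀ f ∈ freeDeg K W a e, φ f ∈ 𝒩 e)
    (ψ : (ι' → MvPolynomial W K) →ₗ[MvPolynomial W K] N)
    (hψ : ∀ e, ∀ f ∈ freeDeg K W a' e, ψ f ∈ 𝒩 e)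
    (hr : ∀ f, ∃ x, φ x = ψ f) :
    ∃ χ : (ι' → MvPolynomial W K) →ₗ[MvPolynomial W K] (ι → MvPolynomial W K),
      (∀ e, ∀ f ∈ freeDeg K W a' e, χ f ∈ freeDeg K W a e) ∧ ∀ f, φ (χ f) = ψ f := by
  classical
  cases nonempty_fintype ι'
  have h1 : ∀ b : ι', ∃ x ∈ freeDeg K W a (a' b), φ x = ψ (Pi.single b 1) := by
    intro b
    obtain ⟨x, hx⟩ := hr (Pi.single b 1)
    have hb : ψ (Pi.single b 1) ∈ 𝒩 (a' b) := by
      refine hψ _ _ (single_mem_freeDeg ?_)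
      rw [sub_self]
      simpa using monomial_mem_ringDeg (W := W) (0 : W →₀ ℕ) (1 : K)
    obtain ⟨x', hx', h⟩ := exists_homogeneous_preimage h𝒩 φ.toAddMonoidHom hφ x
      (by simpa [hx] using hb)
    exact ⟨x', hx', by simpa [hx] using h⟩
  choose x hx hxψ using h1
  refine ⟨Fintype.linearCombination (MvPolynomial W K) x, fun e f hf => ?_, fun f => ?_⟩
  · rw [Fintype.linearCombination_apply]
    refine sum_mem fun b _ => mem_freeDeg.2 fun c => ?_
    have := mul_mem_ringDeg (mem_freeDeg.1 hf b) (mem_freeDeg.1 (hx b) c)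
    rwa [show e - a' b + (a' b - a c) = e - a c by ring] at this
  · rw [Fintype.linearCombination_apply, map_sum]
    simp only [map_smul, hxψ]
    conv_rhs => rw [← Finset.univ_sum_single f, map_sum]
    refine Finset.sum_congr rfl fun b _ => ?_
    rw [← map_smul, ← Pi.single_smul, smul_eq_mul, mul_one]

end Components

/-! ### Comparison of graded free resolutions -/

namespace GradedFreeResolution

variable {K : Type*} [Field K] {W : Type*}
  {M : Type*} [AddCommGroup M] [Module (MvPolynomial W K) M] {ℳ : ℤ → AddSubgroup M}
  (F F' : GradedFreeResolution K W ℳ)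

/-- A homogeneous chain map between two graded free resolutions of `M` which lifts the identity. -/
structure Comparison where
  map : ∀ i, (Fin (F.rank i) → MvPolynomial W K) →ₗ[MvPolynomial W K]
    (Fin (F'.rank i) → MvPolynomial W K)
  map_homogeneous : ∀ i e, ∀ f ∈ freeDeg K W (F.shift i) e, map i f ∈ freeDeg K W (F'.shift i) e
  aug_map : ∀ f, F'.aug (map 0 f) = F.aug f
  d_map : ∀ i f, F'.d i (map (i + 1) f) = map i (F.d i f)

/-- The maps `Fᵢ → F'ᵢ` from which the construction of a chain map can be continued. -/
def Extendable (i : ℕ) (φ : (Fin (F.rank i) → MvPolynomial W K) →ₗ[MvPolynomial W K]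
    (Fin (F'.rank i) → MvPolynomial W K)) : Prop :=
  (∀ e, ∀ f ∈ freeDeg K W (F.shift i) e, φ f ∈ freeDeg K W (F'.shift i) e) ∧
    ∀ f, ∃ x, F'.d i x = φ (F.d i f)

theorem exists_extendable_zero (hℳ : HasProjections ℳ) :
    ∃ φ, Extendable F F' 0 φ ∧ ∀ f, F'.aug (φ f) = F.aug f := by
  obtain ⟨φ, h1, h2⟩ := exists_homogeneous_lift hℳ F'.aug F'.aug_homogeneous F.aug
    F.aug_homogeneous fun f => F'.aug_surjective _
  refine ⟨φ, ⟨h1, fun f => (F'.exact_aug _).1 ?_⟩, h2⟩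
  rw [h2]
  exact (F.exact_aug _).2 ⟨f, rfl⟩

theorem exists_extendable_succ (i : ℕ) (φ) (hφ : Extendable F F' i φ) :
    ∃ ψ, Extendable F F' (i + 1) ψ ∧ ∀ f, F'.d i (ψ f) = φ (F.d i f) := by
  obtain ⟨ψ, h1, h2⟩ := exists_homogeneous_lift (hasProjections_freeDeg (F'.shift i))
    (F'.d i) (F'.d_homogeneous i) (φ ∘ₗ F.d i)
    (fun e f hf => hφ.1 e _ (F.d_homogeneous i e f hf)) hφ.2
  refine ⟨ψ, ⟨h1, fun f => (F'.exact_d i _).1 ?_⟩, h2⟩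
  rw [h2, LinearMap.comp_apply, (F.exact_d i _).2 ⟨f, rfl⟩, map_zero]

theorem nonempty_comparison (hℳ : HasProjections ℳ) : Nonempty (Comparison F F') := by
  obtain ⟨φ₀, h₀, haug⟩ := exists_extendable_zero F F' hℳ
  choose next hnext hd using exists_extendable_succ F F'
  let seq : ∀ i, {φ // Extendable F F' i φ} := fun i =>
    Nat.rec ⟨φ₀, h₀⟩ (fun i φ => ⟨next i φ.1 φ.2, hnext i φ.1 φ.2⟩) i
  exact ⟨⟨fun i => (seq i).1, fun i => (seq i).2.1, haug, fun i => hd i (seq i).1 (seq i).2⟩⟩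

variable {F F'}

/-- The difference of `ψ ∘ φ` and the identity is a chain map which lifts the zero map, so it is
null-homotopic: in degree `0`, it factors through the differential. -/
theorem exists_homotopy_zero (φ : Comparison F F') (ψ : Comparison F' F) :
    ∃ h : (Fin (F.rank 0) → MvPolynomial W K) →ₗ[MvPolynomial W K]
        (Fin (F.rank 1) → MvPolynomial W K),
      ∀ f, F.d 0 (h f) = ψ.map 0 (φ.map 0 f) - f := by
  obtain ⟨h, hh⟩ := Module.projective_lifting_property
    (F.d 0).rangeRestrict ((ψ.map 0 ∘ₗ φ.map 0 - LinearMap.id).codRestrict _ fun f =>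
      (F.exact_aug _).1 (by simp [ψ.aug_map, φ.aug_map])) (LinearMap.surjective_rangeRestrict _)
  exact ⟨h, fun f => congrArg Subtype.val (LinearMap.congr_fun hh f)⟩

/-- One step in the construction of a homotopy from the identity to `ψ ∘ φ`: the hypothesis says
that the difference which the next map has to account for consists of cycles. -/
theorem exists_homotopy_step (φ : Comparison F F') (ψ : Comparison F' F) (i : ℕ)
    (h : (Fin (F.rank i) → MvPolynomial W K) →ₗ[MvPolynomial W K]
        (Fin (F.rank (i + 1)) → MvPolynomial W K))
    (hh : ∀ f, F.d i (h (F.d i f)) = ψ.map i (φ.map i (F.d i f)) - F.d i f) :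
    ∃ h' : (Fin (F.rank (i + 1)) → MvPolynomial W K) →ₗ[MvPolynomial W K]
        (Fin (F.rank (i + 2)) → MvPolynomial W K),
      ∀ f, F.d (i + 1) (h' f) = ψ.map (i + 1) (φ.map (i + 1) f) - f - h (F.d i f) := by
  obtain ⟨h', hh'⟩ := Module.projective_lifting_property
    (F.d (i + 1)).rangeRestrict
    ((ψ.map (i + 1) ∘ₗ φ.map (i + 1) - LinearMap.id - h ∘ₗ F.d i).codRestrict _ fun f =>
      (F.exact_d i _).1 (by simp [ψ.d_map, φ.d_map, hh])) (LinearMap.surjective_rangeRestrict _)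
  exact ⟨h', fun f => congrArg Subtype.val (LinearMap.congr_fun hh' f)⟩

theorem exists_homotopy (φ : Comparison F F') (ψ : Comparison F' F) (i : ℕ) :
    ∃ (h : (Fin (F.rank i) → MvPolynomial W K) →ₗ[MvPolynomial W K]
        (Fin (F.rank (i + 1)) → MvPolynomial W K))
      (h' : (Fin (F.rank (i + 1)) → MvPolynomial W K) →ₗ[MvPolynomial W K]
        (Fin (F.rank (i + 2)) → MvPolynomial W K)),
      ∀ f, ψ.map (i + 1) (φ.map (i + 1) f) - f = F.d (i + 1) (h' f) + h (F.d i f) := by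
  induction i with
  | zero =>
    obtain ⟨h, hh⟩ := exists_homotopy_zero φ ψ
    obtain ⟨h', hh'⟩ := exists_homotopy_step φ ψ 0 h fun f => hh _
    exact ⟨h, h', fun f => by rw [hh']; abel⟩
  | succ i ih =>
    obtain ⟨h₀, h, hh⟩ := ih
    obtain ⟨h', hh'⟩ := exists_homotopy_step φ ψ (i + 1) h fun f => by
      have := hh (F.d (i + 1) f)
      rw [(F.exact_d i _).2 ⟨f, rfl⟩, map_zero, add_zero] at this
      exact this.symm
    exact ⟨h, h', fun f => by rw [hh']; abel⟩

/-- The map `Fᵢ ⊗ K → F'ᵢ ⊗ K` induced by a chain map. -/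
def Comparison.fiberMap (φ : Comparison F F') (i : ℕ) :
    F.Fiber i →ₗ[MvPolynomial W K] F'.Fiber i :=
  (φ.map i).rTensor (Residue K W)

theorem Comparison.fiberD_fiberMap (φ : Comparison F F') (i : ℕ) (x : F.Fiber (i + 1)) :
    F'.fiberD i (φ.fiberMap (i + 1) x) = φ.fiberMap i (F.fiberD i x) := by
  unfold fiberD fiberMap
  rw [← LinearMap.comp_apply, ← LinearMap.comp_apply, ← LinearMap.rTensor_comp,
    ← LinearMap.rTensor_comp]
  congr 2
  ext1 f
  exact LinearMap.ext fun x => φ.d_map i _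

theorem Comparison.fiberMap_mem_cycles (φ : Comparison F F') (i : ℕ) {x : F.Fiber i}
    (hx : x ∈ F.cycles i) : φ.fiberMap i x ∈ F'.cycles i := by
  cases i with
  | zero => trivial
  | succ i =>
    change F'.fiberD i _ = 0
    rw [φ.fiberD_fiberMap, show F.fiberD i x = 0 from hx, map_zero]

theorem Comparison.fiberMap_mem_fiberDeg (φ : Comparison F F') {i : ℕ} {j : ℤ} {x : F.Fiber i}
    (hx : x ∈ F.fiberDeg i j) : φ.fiberMap i x ∈ F'.fiberDeg i j := by
  obtain ⟨f, hf, rfl⟩ := hx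
  exact ⟨φ.map i f, φ.map_homogeneous i j f hf, rfl⟩

/-- On cycles of `F ⊗ K`, a composite of comparison maps is the identity up to boundaries. -/
theorem Comparison.fiberMap_fiberMap_sub_mem (φ : Comparison F F') (ψ : Comparison F' F) (i : ℕ)
    {x : F.Fiber i} (hx : x ∈ F.cycles i) :
    ψ.fiberMap i (φ.fiberMap i x) - x ∈ LinearMap.range (F.fiberD i) := by
  cases i with
  | zero =>
    obtain ⟨h, hh⟩ := exists_homotopy_zero φ ψ
    refine ⟨h.rTensor _ x, ?_⟩
    have := congrArg (LinearMap.rTensor (Residue K W))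
      (LinearMap.ext hh : F.d 0 ∘ₗ h = ψ.map 0 ∘ₗ φ.map 0 - LinearMap.id)
    simp only [LinearMap.rTensor_comp, LinearMap.rTensor_sub, LinearMap.rTensor_id] at this
    exact LinearMap.congr_fun this x
  | succ i =>
    obtain ⟨h, h', hh⟩ := exists_homotopy φ ψ i
    refine ⟨h'.rTensor _ x, ?_⟩
    have := congrArg (LinearMap.rTensor (Residue K W))
      (LinearMap.ext hh : ψ.map (i + 1) ∘ₗ φ.map (i + 1) - LinearMap.id =
        F.d (i + 1) ∘ₗ h' + h ∘ₗ F.d i)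
    simp only [LinearMap.rTensor_comp, LinearMap.rTensor_sub, LinearMap.rTensor_id,
      LinearMap.rTensor_add] at this
    have h2 := LinearMap.congr_fun this x
    have h3 : h.rTensor (Residue K W) ((F.d i).rTensor (Residue K W) x) = 0 := by
      rw [show (F.d i).rTensor (Residue K W) x = 0 from hx, map_zero]
    simp only [LinearMap.sub_apply, LinearMap.add_apply, LinearMap.comp_apply, h3, add_zero] at h2
    exact h2.symm

theorem torDeg_ne_bot_iff_exists {i : ℕ} {j : ℤ} :
    F.torDeg i j ≠ ⊥ ↔
      ∃ x ∈ F.fiberDeg i j, x ∈ F.cycles i ∧ x ∉ LinearMap.range (F.fiberD i) := by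
  rw [Ne, torDeg, AddSubgroup.map_eq_bot_iff, SetLike.not_le_iff_exists]
  constructor
  · rintro ⟨x, ⟨h1, h2⟩, h3⟩
    exact ⟨x, h1, h2, fun h => h3 ((Submodule.Quotient.mk_eq_zero _).2 h)⟩
  · rintro ⟨x, h1, h2, h3⟩
    exact ⟨x, ⟨h1, h2⟩, fun h => h3 ((Submodule.Quotient.mk_eq_zero _).1 h)⟩

theorem torDeg_ne_bot_of_comparison (φ : Comparison F F') (ψ : Comparison F' F) {i : ℕ} {j : ℤ}
    (h : F.torDeg i j ≠ ⊥) : F'.torDeg i j ≠ ⊥ := by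
  rw [torDeg_ne_bot_iff_exists] at h ⊢
  obtain ⟨x, h1, h2, h3⟩ := h
  refine ⟨φ.fiberMap i x, φ.fiberMap_mem_fiberDeg h1, φ.fiberMap_mem_cycles i h2, ?_⟩
  rintro ⟨y, hy⟩
  refine h3 ?_
  have h4 := φ.fiberMap_fiberMap_sub_mem ψ i h2
  rw [← hy, ← ψ.fiberD_fiberMap] at h4
  exact (Submodule.sub_mem_iff_right _ (LinearMap.mem_range_self _ _)).1 h4

/-- Whether `Tor_i(M, K)_j` vanishes does not depend on the resolution. -/
theorem torDeg_ne_bot_iff (hℳ : HasProjections ℳ) (F F' : GradedFreeResolution K W ℳ) {i : ℕ}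
    {j : ℤ} : F.torDeg i j ≠ ⊥ ↔ F'.torDeg i j ≠ ⊥ := by
  obtain ⟨φ⟩ := nonempty_comparison F F' hℳ
  obtain ⟨ψ⟩ := nonempty_comparison F' F hℳ
  exact ⟨torDeg_ne_bot_of_comparison φ ψ, torDeg_ne_bot_of_comparison ψ φ⟩

/-! ### Minimal resolutions -/

theorem tmul_residue_eq_zero {N : Type*} [AddCommGroup N] [Module (MvPolynomial W K) N] {x : N}
    (hx : x ∈ irrelevant K W • (⊤ : Submodule (MvPolynomial W K) N)) (r : Residue K W) :
    x ⊗ₜ[MvPolynomial W K] r = 0 := by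
  induction hx using Submodule.smul_induction_on' with
  | smul p hp n _ =>
    rw [TensorProduct.smul_tmul]
    obtain ⟨q, rfl⟩ := Ideal.Quotient.mk_surjective r
    have : p • (Ideal.Quotient.mk (irrelevant K W) q) = 0 :=
      Ideal.Quotient.eq_zero_iff_mem.2 (Ideal.mul_mem_right _ _ hp)
    rw [this, TensorProduct.tmul_zero]
  | add x _ y _ hx hy => rw [TensorProduct.add_tmul, hx, hy, add_zero]

theorem IsMinimal.fiberD_eq_zero (hF : F.IsMinimal) (i : ℕ) : F.fiberD i = 0 := by
  refine TensorProduct.ext' fun x r => ?_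
  exact tmul_residue_eq_zero (hF i ⟨x, rfl⟩) r

theorem IsMinimal.mem_cycles (hF : F.IsMinimal) (i : ℕ) (x : F.Fiber i) : x ∈ F.cycles i := by
  cases i with
  | zero => trivial
  | succ i => exact LinearMap.congr_fun (hF.fiberD_eq_zero i) x

variable (F) in
/-- The coordinates of `Fᵢ ⊗ K` with respect to the basis of `Fᵢ`. -/
def fiberEquiv (i : ℕ) : F.Fiber i ≃ₗ[MvPolynomial W K] (Fin (F.rank i) → Residue K W) :=
  TensorProduct.comm _ _ _ ≪≫ₗ TensorProduct.piScalarRight (MvPolynomial W K)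
    (MvPolynomial W K) (Residue K W) (Fin (F.rank i))

theorem fiberEquiv_tmul (i : ℕ) (f : Fin (F.rank i) → MvPolynomial W K) (r : Residue K W) :
    F.fiberEquiv i (f ⊗ₜ r) = fun b => f b • r := by
  simp [fiberEquiv]

theorem irrelevant_eq_ker : irrelevant K W = RingHom.ker (MvPolynomial.constantCoeff (σ := W)) := by
  ext p
  rw [irrelevant, ← Set.image_univ, MvPolynomial.mem_ideal_span_X_image, RingHom.mem_ker,
    MvPolynomial.constantCoeff_eq]
  refine ⟨fun h => ?_, fun h u hu => ?_⟩
  · by_contra h0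
    obtain ⟨i, -, hi⟩ := h 0 (MvPolynomial.mem_support_iff.2 h0)
    exact hi rfl
  · by_contra! h0
    obtain rfl : u = 0 := Finsupp.ext fun i => h0 i (Set.mem_univ i)
    exact MvPolynomial.mem_support_iff.1 hu h

instance : Nontrivial (Residue K W) := by
  refine Ideal.Quotient.nontrivial_iff.2 ?_
  rw [irrelevant_eq_ker]
  exact RingHom.ker_ne_top _

/-- Minimal resolutions have the same ranks. -/
theorem IsMinimal.rank_eq (hℳ : HasProjections ℳ) (hF : F.IsMinimal) (hF' : F'.IsMinimal)
    (i : ℕ) : F.rank i = F'.rank i := by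
  obtain ⟨φ⟩ := nonempty_comparison F F' hℳ
  obtain ⟨ψ⟩ := nonempty_comparison F' F hℳ
  have h1 : ∀ x, ψ.fiberMap i (φ.fiberMap i x) = x := fun x => by
    have := φ.fiberMap_fiberMap_sub_mem ψ i (hF.mem_cycles i x)
    rw [hF.fiberD_eq_zero, LinearMap.range_zero, Submodule.mem_bot, sub_eq_zero] at this
    exact this
  have h2 : ∀ x, φ.fiberMap i (ψ.fiberMap i x) = x := fun x => by
    have := ψ.fiberMap_fiberMap_sub_mem φ i (hF'.mem_cycles i x)
    rw [hF'.fiberD_eq_zero, LinearMap.range_zero, Submodule.mem_bot, sub_eq_zero] at this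
    exact this
  let e : F.Fiber i ≃ₗ[MvPolynomial W K] F'.Fiber i :=
    LinearEquiv.ofLinearMap (φ.fiberMap i) (ψ.fiberMap i) (LinearMap.ext h2) (LinearMap.ext h1)
  let e' := (F.fiberEquiv i).symm ≪≫ₗ e ≪≫ₗ F'.fiberEquiv i
  have e'' := LinearEquiv.extendScalarsOfSurjective (S := Residue K W)
    (Ideal.Quotient.mk_surjective (I := irrelevant K W)) e'
  simpa using e''.finrank_eq

/-- For a minimal resolution, `Tor_i(M, K)_j` is nonzero exactly when some basis vector of `Fᵢ`
has degree `j`. -/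
theorem IsMinimal.torDeg_ne_bot_iff (hF : F.IsMinimal) {i : ℕ} {j : ℤ} :
    F.torDeg i j ≠ ⊥ ↔ ∃ b, F.shift i b = j := by
  rw [torDeg_ne_bot_iff_exists]
  simp only [hF.fiberD_eq_zero, LinearMap.range_zero, Submodule.mem_bot]
  constructor
  · rintro ⟨x, ⟨f, hf, rfl⟩, -, hx⟩
    by_contra! h
    apply hx
    change f ⊗ₜ (1 : Residue K W) = 0
    rw [← (F.fiberEquiv i).map_eq_zero_iff, fiberEquiv_tmul]
    funext b
    have : f b ∈ irrelevant K W := by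
      rw [irrelevant_eq_ker, RingHom.mem_ker, MvPolynomial.constantCoeff_eq]
      by_contra h0
      have := hf b 0 (MvPolynomial.mem_support_iff.2 h0)
      simp only [map_zero, Nat.cast_zero, zero_add] at this
      exact h b this
    exact Ideal.Quotient.eq_zero_iff_mem.2 (Ideal.mul_mem_right _ _ this)
  · rintro ⟨b, rfl⟩
    refine ⟨Pi.single b 1 ⊗ₜ 1, ⟨Pi.single b 1, single_mem_freeDeg ?_, rfl⟩,
      hF.mem_cycles _ _, fun h => ?_⟩
    · rw [sub_self]
      simpa using monomial_mem_ringDeg (W := W) (0 : W →₀ ℕ) (1 : K)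
    · have := congrFun (congrArg (F.fiberEquiv i) h) b
      rw [fiberEquiv_tmul] at this
      simp at this

end GradedFreeResolution

/-! ### The staircase complex and its exactness -/

section Exactness

variable {R : Type*} [CommRing R]

/-- If `a` is regular modulo `I` and `b` is regular modulo `I + (a)`, then the relations modulo `I`
between the monomials `a ^ (n - i) * b ^ i` are generated by the obvious ones. -/
theorem exists_syzygy_of_sum_mem {I : Ideal R} {a b : R} (ha : ∀ x, a * x ∈ I → x ∈ I)
    (hb : ∀ x, b * x ∈ I ⊔ Ideal.span {a} → x ∈ I ⊔ Ideal.span {a}) (n : ℕ) (c : ℕ → R)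
    (hc : ∑ i ∈ Finset.range (n + 1), c i * (a ^ (n - i) * b ^ i) ∈ I) :
    ∃ g : ℕ → R, g 0 = 0 ∧ (∀ i, n < i → g i = 0) ∧
      ∀ i ≤ n, c i - (a * g i - b * g (i + 1)) ∈ I := by
  induction n generalizing c with
  | zero =>
    refine ⟨0, rfl, fun _ _ => rfl, fun i hi => ?_⟩
    obtain rfl : i = 0 := by omega
    simpa using hc
  | succ n ih =>
    have hsum : ∀ c : ℕ → R, ∑ i ∈ Finset.range (n + 1), c i * (a ^ (n + 1 - i) * b ^ i) =
        a * ∑ i ∈ Finset.range (n + 1), c i * (a ^ (n - i) * b ^ i) := by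
      intro c
      rw [Finset.mul_sum]
      refine Finset.sum_congr rfl fun i hi => ?_
      rw [Nat.succ_sub (Finset.mem_range_succ_iff.1 hi), pow_succ]
      ring
    rw [Finset.sum_range_succ, hsum, Nat.sub_self, pow_zero, one_mul] at hc
    have hbpow : ∀ (k : ℕ) (x : R), b ^ k * x ∈ I ⊔ Ideal.span {a} → x ∈ I ⊔ Ideal.span {a} := by
      intro k
      induction k with
      | zero => intro x hx; simpa using hx
      | succ k ihk => intro x hx; exact ihk x (hb _ (by rwa [← mul_assoc, ← pow_succ']))
    have htop : c (n + 1) ∈ I ⊔ Ideal.span {a} := by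
      refine hbpow (n + 1) _ ?_
      rw [mul_comm]
      refine (Submodule.add_mem_iff_right _ ?_).1 (Ideal.mem_sup_left hc)
      exact Ideal.mem_sup_right (Ideal.mul_mem_right _ _ (Ideal.mem_span_singleton_self a))
    obtain ⟨y, hy, z, hz, hyz⟩ := Submodule.mem_sup.1 htop
    obtain ⟨w, rfl⟩ := Ideal.mem_span_singleton'.1 hz
    -- Move the leading term down with the relation between the last two monomials.
    obtain ⟨g, hg0, hgn, hg⟩ := ih (fun i => c i + if i = n then b * w else 0) (by
      apply ha
      rw [← hsum]
      simp only [add_mul, Finset.sum_add_distrib, hsum]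
      simp only [ite_mul, zero_mul, Finset.sum_ite_eq', Finset.mem_range, Nat.lt_succ_self,
        if_true]
      have h1 := I.sub_mem hc (I.mul_mem_right (b ^ (n + 1)) hy)
      rw [← hyz] at h1
      convert h1 using 1
      rw [Nat.sub_self]
      ring)
    refine ⟨fun i => if i = n + 1 then w else g i, ?_, fun i hi => ?_, fun i hi => ?_⟩ <;>
      beta_reduce
    · simpa using hg0
    · rw [if_neg (by omega)]
      exact hgn i (by omega)
    · rcases Nat.lt_or_ge n i with h | h
      · obtain rfl : i = n + 1 := by omega
        rw [if_pos rfl, if_neg (by omega), hgn _ (by omega), ← hyz]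
        convert hy using 1
        ring
      · have h2 := hg i h
        rw [if_neg (by omega)]
        rcases eq_or_ne i n with rfl | hin
        · rw [if_pos rfl, hgn (i + 1) (by omega)] at h2
          rw [if_pos rfl]
          convert h2 using 1
          ring
        · rw [if_neg hin, add_zero] at h2
          rwa [if_neg (by omega)]


/-- The same as `exists_syzygy_of_sum_mem` for a relation which involves only the monomials with
exponents `t ≤ i ≤ s`, where `b` is regular modulo `I` too. -/
theorem exists_syzygy_of_sum_mem_of_support {I : Ideal R} {a b : R} (ha : ∀ x, a * x ∈ I → x ∈ I)
    (hbI : ∀ x, b * x ∈ I → x ∈ I)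
    (hb : ∀ x, b * x ∈ I ⊔ Ideal.span {a} → x ∈ I ⊔ Ideal.span {a}) {s t : ℕ} (hts : t ≤ s)
    (c : ℕ → R) (hct : ∀ i, i < t → c i = 0) (hcs : ∀ i, s < i → c i = 0)
    (hc : ∑ i ∈ Finset.range (s + 1), c i * (a ^ (s - i) * b ^ i) ∈ I) :
    ∃ g : ℕ → R, (∀ i, ¬ (t < i ∧ i ≤ s) → g i = 0) ∧
      ∀ i, c i - (a * g i - b * g (i + 1)) ∈ I := by
  obtain ⟨n, rfl⟩ := Nat.exists_eq_add_of_le hts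
  have hbpow : ∀ (k : ℕ) (x : R), b ^ k * x ∈ I → x ∈ I := by
    intro k
    induction k with
    | zero => intro x hx; simpa using hx
    | succ k ihk => intro x hx; exact ihk x (hbI _ (by rwa [← mul_assoc, ← pow_succ']))
  have hsum : ∑ i ∈ Finset.range (n + 1), c (t + i) * (a ^ (n - i) * b ^ i) ∈ I := by
    refine hbpow t _ ?_
    rw [add_assoc, Finset.sum_range_add, Finset.sum_eq_zero fun i hi => by
      rw [hct i (Finset.mem_range.1 hi), zero_mul], zero_add] at hc
    rw [Finset.mul_sum]
    convert hc using 2 with i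
    rw [Nat.add_sub_add_left, pow_add]
    ring
  obtain ⟨g, hg0, hgn, hg⟩ := exists_syzygy_of_sum_mem ha hb n _ hsum
  refine ⟨fun i => g (i - t), fun i hi => ?_, fun i => ?_⟩ <;> beta_reduce
  · rcases Nat.lt_or_ge t i with h | h
    · exact hgn _ (by omega)
    · rwa [Nat.sub_eq_zero_of_le h]
  · rcases Nat.lt_or_ge i t with h | h
    · rw [hct i h, Nat.sub_eq_zero_of_le h.le, Nat.sub_eq_zero_of_le h, hg0]
      simp
    · obtain ⟨k, rfl⟩ := Nat.exists_eq_add_of_le h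
      rw [add_assoc, Nat.add_sub_cancel_left, Nat.add_sub_cancel_left]
      rcases Nat.lt_or_ge n k with h' | h'
      · rw [hcs _ (by omega), hgn _ h', hgn _ (by omega)]
        simp
      · exact hg k h'

/-- The cells of the staircase complex. Its vertices are the `(i, j)` with `j ≤ i ≤ s`, and the
other cells are the unit segments and unit squares all of whose vertices are among these, named by
their top corner. `cells s n` holds the cells of dimension `n - 1`, where the only cell of dimension
`-1` is written `(false, 0, 0)`. The Boolean tells apart the edges from `(i - 1, j)` to `(i, j)`
(`false`) and from `(i, j - 1)` to `(i, j)` (`true`). -/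
def cells (s : ℕ) : ℕ → Finset (Bool × ℕ × ℕ)
  | 0 => {(false, 0, 0)}
  | 1 => (Finset.univ ×ˢ Finset.range (s + 1) ×ˢ Finset.range (s + 1)).filter
      fun x => x.1 = false ∧ x.2.2 ≤ x.2.1
  | 2 => (Finset.univ ×ˢ Finset.range (s + 1) ×ˢ Finset.range (s + 1)).filter
      fun x => (x.1 = false ∧ x.2.2 < x.2.1) ∨ (x.1 = true ∧ 1 ≤ x.2.2 ∧ x.2.2 ≤ x.2.1)
  | 3 => (Finset.univ ×ˢ Finset.range (s + 1) ×ˢ Finset.range (s + 1)).filter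
      fun x => x.1 = false ∧ 1 ≤ x.2.2 ∧ x.2.2 < x.2.1
  | _ => ∅

theorem mem_cells_zero {s : ℕ} {x : Bool × ℕ × ℕ} : x ∈ cells s 0 ↔ x = (false, 0, 0) :=
  Finset.mem_singleton

theorem mem_cells_one {s : ℕ} {x : Bool × ℕ × ℕ} :
    x ∈ cells s 1 ↔ x.1 = false ∧ x.2.2 ≤ x.2.1 ∧ x.2.1 ≤ s := by
  simp only [cells, Finset.mem_filter, Finset.mem_product, Finset.mem_univ, Finset.mem_range,
    true_and]
  grind

theorem mem_cells_two {s : ℕ} {x : Bool × ℕ × ℕ} :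
    x ∈ cells s 2 ↔ ((x.1 = false ∧ x.2.2 < x.2.1) ∨ (x.1 = true ∧ 1 ≤ x.2.2 ∧ x.2.2 ≤ x.2.1)) ∧
      x.2.1 ≤ s := by
  simp only [cells, Finset.mem_filter, Finset.mem_product, Finset.mem_univ, Finset.mem_range,
    true_and]
  grind

theorem mem_cells_three {s : ℕ} {x : Bool × ℕ × ℕ} :
    x ∈ cells s 3 ↔ x.1 = false ∧ 1 ≤ x.2.2 ∧ x.2.2 < x.2.1 ∧ x.2.1 ≤ s := by
  simp only [cells, Finset.mem_filter, Finset.mem_product, Finset.mem_univ, Finset.mem_range,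
    true_and]
  grind

/-- The generator of the `s`-th power of `(a₁ a₂, a₁ b₂, b₁ b₂)` which belongs to the vertex
`(i, j)`. -/
def vertexLabel (a₁ a₂ b₁ b₂ : R) (s i j : ℕ) : R :=
  a₁ ^ (s - j) * a₂ ^ (s - i) * b₁ ^ j * b₂ ^ i

/-- The augmentation of the staircase complex, which maps a vertex to its label. Its value is stored
as the coefficient of the cell `(false, 0, 0)`. -/
def vertexMap (a₁ a₂ b₁ b₂ : R) (s : ℕ) : (Bool × ℕ × ℕ → R) →ₗ[R] (Bool × ℕ × ℕ → R) :=
  LinearMap.pi fun x => if x = (false, 0, 0) then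
    ∑ j ∈ Finset.range (s + 1), ∑ i ∈ Finset.range (s + 1),
      vertexLabel a₁ a₂ b₁ b₂ s i j • LinearMap.proj (false, i, j) else 0

/-- The labelled boundary of an edge. -/
def edgeMap (a₁ a₂ b₁ b₂ : R) : (Bool × ℕ × ℕ → R) →ₗ[R] (Bool × ℕ × ℕ → R) :=
  LinearMap.pi fun x => if x.1 = false then
    a₂ • LinearMap.proj (false, x.2.1, x.2.2) - b₂ • LinearMap.proj (false, x.2.1 + 1, x.2.2) +
      a₁ • LinearMap.proj (true, x.2.1, x.2.2) - b₁ • LinearMap.proj (true, x.2.1, x.2.2 + 1)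
    else 0

/-- The labelled boundary of a square. -/
def squareMap (a₁ a₂ b₁ b₂ : R) : (Bool × ℕ × ℕ → R) →ₗ[R] (Bool × ℕ × ℕ → R) :=
  LinearMap.pi fun x => if x.1 = false then
    a₁ • LinearMap.proj (false, x.2.1, x.2.2) - b₁ • LinearMap.proj (false, x.2.1, x.2.2 + 1)
    else b₂ • LinearMap.proj (false, x.2.1 + 1, x.2.2) -
      a₂ • LinearMap.proj (false, x.2.1, x.2.2)

/-- The differentials of the staircase complex, augmented to the ring in degree `0`. -/
def cellMap (a₁ a₂ b₁ b₂ : R) (s : ℕ) : ℕ → (Bool × ℕ × ℕ → R) →ₗ[R] (Bool × ℕ × ℕ → R)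
  | 0 => vertexMap a₁ a₂ b₁ b₂ s
  | 1 => edgeMap a₁ a₂ b₁ b₂
  | 2 => squareMap a₁ a₂ b₁ b₂
  | _ => 0

variable {a₁ a₂ b₁ b₂ : R} {s : ℕ}

theorem vertexMap_apply (f : Bool × ℕ × ℕ → R) :
    vertexMap a₁ a₂ b₁ b₂ s f (false, 0, 0) = ∑ j ∈ Finset.range (s + 1),
      ∑ i ∈ Finset.range (s + 1), vertexLabel a₁ a₂ b₁ b₂ s i j * f (false, i, j) := by
  simp [vertexMap]

theorem vertexMap_apply_of_ne (f : Bool × ℕ × ℕ → R) {x : Bool × ℕ × ℕ}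
    (hx : x ≠ (false, 0, 0)) : vertexMap a₁ a₂ b₁ b₂ s f x = 0 := by
  simp [vertexMap, hx]

theorem edgeMap_false (f : Bool × ℕ × ℕ → R) (i j : ℕ) :
    edgeMap a₁ a₂ b₁ b₂ f (false, i, j) = a₂ * f (false, i, j) - b₂ * f (false, i + 1, j) +
      a₁ * f (true, i, j) - b₁ * f (true, i, j + 1) := by
  simp [edgeMap]

theorem edgeMap_true (f : Bool × ℕ × ℕ → R) (i j : ℕ) :
    edgeMap a₁ a₂ b₁ b₂ f (true, i, j) = 0 := by
  simp [edgeMap]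

theorem squareMap_false (f : Bool × ℕ × ℕ → R) (i j : ℕ) :
    squareMap a₁ a₂ b₁ b₂ f (false, i, j) = a₁ * f (false, i, j) - b₁ * f (false, i, j + 1) := by
  simp [squareMap]

theorem squareMap_true (f : Bool × ℕ × ℕ → R) (i j : ℕ) :
    squareMap a₁ a₂ b₁ b₂ f (true, i, j) = b₂ * f (false, i + 1, j) - a₂ * f (false, i, j) := by
  simp [squareMap]

/-- The differentials respect the supports. -/
theorem cellMap_support (n : ℕ) (f : Bool × ℕ × ℕ → R) (hf : ∀ x ∉ cells s (n + 1), f x = 0) :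
    ∀ x ∉ cells s n, cellMap a₁ a₂ b₁ b₂ s n f x = 0 := by
  rintro ⟨t, i, j⟩ hx
  match n, hf, hx with
  | 0, _, hx => exact vertexMap_apply_of_ne f fun h => hx (mem_cells_zero.2 h)
  | 1, hf, hx =>
    cases t with
    | true => exact edgeMap_true f i j
    | false =>
      rw [mem_cells_one] at hx
      have h : ∀ x, x ∉ cells s 2 → f x = 0 := hf
      simp only [mem_cells_two] at h
      rw [cellMap, edgeMap_false, h, h, h, h]
      · simp
      all_goals simp at hx ⊢; try omega
  | 2, hf, hx =>
    rw [mem_cells_two] at hx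
    have h : ∀ x, x ∉ cells s 3 → f x = 0 := hf
    simp only [mem_cells_three] at h
    cases t with
    | true =>
      rw [cellMap, squareMap_true, h, h]
      · simp
      all_goals simp at hx ⊢; try omega
    | false =>
      rw [cellMap, squareMap_false, h, h]
      · simp
      all_goals simp at hx ⊢; try omega
  | n + 3, _, _ => rfl

theorem edgeMap_squareMap (f : Bool × ℕ × ℕ → R) :
    edgeMap a₁ a₂ b₁ b₂ (squareMap a₁ a₂ b₁ b₂ f) = 0 := by
  funext ⟨t, i, j⟩
  cases t with
  | true => exact edgeMap_true _ i j
  | false =>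
    simp only [edgeMap_false, squareMap_false, squareMap_true, Pi.zero_apply]
    ring

theorem vertexMap_edgeMap (f : Bool × ℕ × ℕ → R) (hf : ∀ x ∉ cells s 2, f x = 0) :
    vertexMap a₁ a₂ b₁ b₂ s (edgeMap a₁ a₂ b₁ b₂ f) = 0 := by
  funext x
  rcases eq_or_ne x (false, 0, 0) with rfl | hx
  swap
  · exact vertexMap_apply_of_ne _ hx
  rw [vertexMap_apply]
  simp only [mem_cells_two] at hf
  -- Each of the two families of edges contributes a telescoping sum.
  have h1 : ∀ j, ∑ i ∈ Finset.range (s + 1), vertexLabel a₁ a₂ b₁ b₂ s i j *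
      (a₂ * f (false, i, j) - b₂ * f (false, i + 1, j)) = 0 := by
    intro j
    have h : ∀ i ∈ Finset.range (s + 1), vertexLabel a₁ a₂ b₁ b₂ s i j *
        (a₂ * f (false, i, j) - b₂ * f (false, i + 1, j)) =
        a₁ ^ (s - j) * b₁ ^ j * (a₂ ^ (s + 1 - i) * b₂ ^ i * f (false, i, j)) -
        a₁ ^ (s - j) * b₁ ^ j * (a₂ ^ (s + 1 - (i + 1)) * b₂ ^ (i + 1) * f (false, i + 1, j)) := by
      intro i hi
      rw [vertexLabel, Nat.succ_sub (Finset.mem_range_succ_iff.1 hi), Nat.add_sub_add_right,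
        pow_succ]
      ring
    rw [Finset.sum_congr rfl h, Finset.sum_range_sub', hf, hf]
    · simp
    all_goals simp
  have h2 : ∀ i, ∑ j ∈ Finset.range (s + 1), vertexLabel a₁ a₂ b₁ b₂ s i j *
      (a₁ * f (true, i, j) - b₁ * f (true, i, j + 1)) = 0 := by
    intro i
    have h : ∀ j ∈ Finset.range (s + 1), vertexLabel a₁ a₂ b₁ b₂ s i j *
        (a₁ * f (true, i, j) - b₁ * f (true, i, j + 1)) =
        a₂ ^ (s - i) * b₂ ^ i * (a₁ ^ (s + 1 - j) * b₁ ^ j * f (true, i, j)) -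
        a₂ ^ (s - i) * b₂ ^ i * (a₁ ^ (s + 1 - (j + 1)) * b₁ ^ (j + 1) * f (true, i, j + 1)) := by
      intro j hj
      rw [vertexLabel, Nat.succ_sub (Finset.mem_range_succ_iff.1 hj), Nat.add_sub_add_right,
        pow_succ]
      ring
    rw [Finset.sum_congr rfl h, Finset.sum_range_sub', hf, hf]
    · simp
    all_goals simp
  simp only [edgeMap_false, add_sub_assoc, mul_add, Finset.sum_add_distrib, h1]
  rw [Finset.sum_comm]
  simp [h2]

/-- The conditions on `a₁`, `a₂`, `b₁`, `b₂` under which the staircase complex is exact. -/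
structure IsRegularQuadruple (a₁ a₂ b₁ b₂ : R) : Prop where
  ne_a₁ : a₁ ≠ 0
  ne_a₂ : a₂ ≠ 0
  ne_b₂ : b₂ ≠ 0
  a₁_a₂ : ∀ x, a₂ * x ∈ Ideal.span {a₁} → x ∈ Ideal.span {a₁}
  a₁_b₁ : ∀ x, b₁ * x ∈ Ideal.span {a₁} → x ∈ Ideal.span {a₁}
  a₁_b₂ : ∀ x, b₂ * x ∈ Ideal.span {a₁} → x ∈ Ideal.span {a₁}
  a₂_b₂ : ∀ x, b₂ * x ∈ Ideal.span {a₂} → x ∈ Ideal.span {a₂}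
  a₁_a₂_b₂ : ∀ x, b₂ * x ∈ Ideal.span {a₁} ⊔ Ideal.span {a₂} →
    x ∈ Ideal.span {a₁} ⊔ Ideal.span {a₂}

variable [IsDomain R]

theorem squareMap_injective (hR : IsRegularQuadruple a₁ a₂ b₁ b₂) (k : Bool × ℕ × ℕ → R)
    (hk : ∀ x ∉ cells s 3, k x = 0) (h0 : squareMap a₁ a₂ b₁ b₂ k = 0) : k = 0 := by
  simp only [mem_cells_three] at hk
  have key : ∀ n i j, s < j + n → k (false, i, j) = 0 := by
    intro n
    induction n with
    | zero => intro i j hj; exact hk _ (by simp; omega)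
    | succ n ih =>
      intro i j hj
      have h := congrFun h0 (false, i, j)
      rw [squareMap_false, ih i (j + 1) (by omega), mul_zero, sub_zero] at h
      exact (mul_eq_zero.1 h).resolve_left hR.ne_a₁
  funext ⟨t, i, j⟩
  cases t with
  | true => exact hk _ (by simp)
  | false => exact key (s + 1) i j (by omega)

/-- Exactness at the edges. The rows of a cycle are removed one by one, starting from the top row
`t`: there, the relation shows that `a₁` divides the coefficients of the edges in direction `i`. -/
theorem exists_squareMap_eq (hR : IsRegularQuadruple a₁ a₂ b₁ b₂) (t : ℕ)
    (f : Bool × ℕ × ℕ → R) (hf : ∀ x ∉ cells s 2, f x = 0) (h0 : edgeMap a₁ a₂ b₁ b₂ f = 0)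
    (ht : ∀ x, t ≤ x.2.2 → f x = 0) :
    ∃ k, (∀ x ∉ cells s 3, k x = 0) ∧ squareMap a₁ a₂ b₁ b₂ k = f := by
  induction t generalizing f with
  | zero =>
    refine ⟨0, fun _ _ => rfl, ?_⟩
    rw [map_zero]
    funext x
    exact (ht x (Nat.zero_le _)).symm
  | succ t ih =>
    have hf' := hf
    simp only [mem_cells_two] at hf'
    have hrow : ∀ i, a₂ * f (false, i, t) - b₂ * f (false, i + 1, t) + a₁ * f (true, i, t) = 0 := by
      intro i
      have h := congrFun h0 (false, i, t)
      rwa [edgeMap_false, ht (true, i, t + 1) le_rfl, mul_zero, sub_zero] at h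
    rcases Nat.eq_zero_or_pos t with rfl | htpos
    · have hz : ∀ i, f (true, i, 0) = 0 := fun i => hf' _ (by simp)
      have key : ∀ n i, s < i + n → f (false, i, 0) = 0 := by
        intro n
        induction n with
        | zero => intro i hi; exact hf' _ (by simp; omega)
        | succ n ih =>
          intro i hi
          have h := hrow i
          rw [ih (i + 1) (by omega), hz] at h
          simpa [hR.ne_a₂] using h
      refine ih f hf h0 ?_
      rintro ⟨b, i, j⟩ -
      rcases Nat.eq_zero_or_pos j with rfl | hj
      · cases b with
        | true => exact hz i
        | false => exact key (s + 1) i (by omega)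
      · exact ht _ hj
    · have key : ∀ n i, s < i + n → f (false, i, t) ∈ Ideal.span {a₁} := by
        intro n
        induction n with
        | zero => intro i hi; rw [hf' _ (by simp; omega)]; exact zero_mem _
        | succ n ih =>
          intro i hi
          refine hR.a₁_a₂ _ ?_
          have h := hrow i
          rw [show a₂ * f (false, i, t) = b₂ * f (false, i + 1, t) - a₁ * f (true, i, t) by
            linear_combination h]
          exact sub_mem (Ideal.mul_mem_left _ _ (ih _ (by omega)))
            (Ideal.mul_mem_right _ _ (Ideal.mem_span_singleton_self _))
      have hdvd : ∀ i, ∃ w, f (false, i, t) = a₁ * w := fun i =>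
        Ideal.mem_span_singleton.1 (key (s + 1) i (by omega))
      choose w hw using hdvd
      let k : Bool × ℕ × ℕ → R := fun x => if x.1 = false ∧ x.2.2 = t then w x.2.1 else 0
      have hk : ∀ x ∉ cells s 3, k x = 0 := by
        rintro ⟨b, i, j⟩ hx
        rw [mem_cells_three] at hx
        by_cases hb : b = false ∧ j = t
        · obtain ⟨rfl, rfl⟩ := hb
          have h := hw i
          rw [hf' _ (by simp at hx ⊢; omega)] at h
          simpa [k] using (mul_eq_zero.1 h.symm).resolve_left hR.ne_a₁
        · exact if_neg hb
      have hfk : edgeMap a₁ a₂ b₁ b₂ (f - squareMap a₁ a₂ b₁ b₂ k) = 0 := by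
        rw [map_sub, h0, edgeMap_squareMap, sub_zero]
      have hF : ∀ i j, t ≤ j → (f - squareMap a₁ a₂ b₁ b₂ k) (false, i, j) = 0 := by
        intro i j hj
        rw [Pi.sub_apply, squareMap_false]
        rcases hj.eq_or_lt with rfl | hj
        · simp [k, hw]
        · rw [ht (false, i, j) (Nat.succ_le_of_lt hj)]
          simp [k, hj.ne', (Nat.lt_succ_of_lt hj).ne']
      obtain ⟨k', hk', hkk'⟩ := ih (f - squareMap a₁ a₂ b₁ b₂ k)
        (fun x hx => by
          rw [Pi.sub_apply, hf x hx, zero_sub, neg_eq_zero]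
          exact cellMap_support 2 k hk x hx) hfk (by
        rintro ⟨b, i, j⟩ hj
        cases b with
        | false => exact hF i j hj
        | true =>
          rcases (show t ≤ j from hj).eq_or_lt with rfl | hj
          · have h := congrFun hfk (false, i, t)
            rw [edgeMap_false, hF _ _ le_rfl, hF _ _ le_rfl] at h
            have h2 : (f - squareMap a₁ a₂ b₁ b₂ k) (true, i, t + 1) = 0 := by
              rw [Pi.sub_apply, squareMap_true, ht _ le_rfl]
              simp [k]
            rw [h2] at h
            simpa [hR.ne_a₁] using h
          · rw [Pi.sub_apply, squareMap_true, ht (true, i, j) (Nat.succ_le_of_lt hj)]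
            simp [k, hj.ne'])
      refine ⟨k + k', fun x hx => by rw [Pi.add_apply, hk x hx, hk' x hx, add_zero], ?_⟩
      rw [map_add, hkk', add_sub_cancel]

/-- The top row `t` of a relation between the vertex labels agrees with the top row of the boundary
of a combination of edges: modulo `a₁`, which the edges to the row below contribute, it is a relation
between the monomials `a₂ ^ (s - i) * b₂ ^ i`. The row `t = 0` has no row below, and there the same
holds exactly. -/
theorem exists_row_eq (hR : IsRegularQuadruple a₁ a₂ b₁ b₂) {t : ℕ} (hts : t ≤ s)
    (f : Bool × ℕ × ℕ → R) (hf : ∀ x ∉ cells s 1, f x = 0)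
    (h0 : vertexMap a₁ a₂ b₁ b₂ s f = 0) (ht : ∀ x, t + 1 ≤ x.2.2 → f x = 0) :
    ∃ g h : ℕ → R, (∀ i, ¬ (t < i ∧ i ≤ s) → g i = 0) ∧
      (∀ i, ¬ (1 ≤ t ∧ t ≤ i ∧ i ≤ s) → h i = 0) ∧
      ∀ i, f (false, i, t) = a₂ * g i - b₂ * g (i + 1) + a₁ * h i := by
  simp only [mem_cells_one] at hf
  set S := ∑ i ∈ Finset.range (s + 1), f (false, i, t) * (a₂ ^ (s - i) * b₂ ^ i) with hS
  have hft : ∀ i, i < t → f (false, i, t) = 0 := fun i hi => hf _ (by simp; omega)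
  have hfs : ∀ i, s < i → f (false, i, t) = 0 := fun i hi => hf _ (by simp; omega)
  -- The sum of the row `j` in the relation.
  let T : ℕ → R := fun j =>
    ∑ i ∈ Finset.range (s + 1), vertexLabel a₁ a₂ b₁ b₂ s i j * f (false, i, j)
  have hTt : T t = a₁ ^ (s - t) * (b₁ ^ t * S) := by
    simp only [T, hS, Finset.mul_sum, vertexLabel]
    exact Finset.sum_congr rfl fun i _ => by ring
  have hT : ∑ j ∈ Finset.range t, T j + T t = 0 := by
    have h := congrFun h0 (false, 0, 0)
    rw [vertexMap_apply, Pi.zero_apply] at h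
    obtain ⟨n, rfl⟩ := Nat.exists_eq_add_of_le hts
    rw [add_right_comm, Finset.sum_range_add, Finset.sum_range_succ,
      Finset.sum_eq_zero (s := Finset.range n), add_zero] at h
    · simp only [T, add_right_comm t n 1]
      exact h
    · intro j _
      refine Finset.sum_eq_zero fun i _ => ?_
      rw [ht _ (by simp), mul_zero]
  rcases Nat.eq_zero_or_pos t with rfl | htpos
  · have hS0 : S = 0 := by
      rw [Finset.range_zero, Finset.sum_empty, zero_add, hTt, pow_zero, one_mul] at hT
      exact (mul_eq_zero.1 hT).resolve_left (pow_ne_zero _ hR.ne_a₁)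
    obtain ⟨g, hg, hgc⟩ := exists_syzygy_of_sum_mem_of_support (I := (⊥ : Ideal R)) (a := a₂)
      (b := b₂) (fun x hx => (mul_eq_zero.1 hx).resolve_left hR.ne_a₂)
      (fun x hx => (mul_eq_zero.1 hx).resolve_left hR.ne_b₂)
      (fun x => by rw [bot_sup_eq]; exact hR.a₂_b₂ x) hts _ hft hfs hS0
    refine ⟨g, 0, hg, fun _ _ => rfl, fun i => ?_⟩
    rw [Pi.zero_apply, mul_zero, add_zero]
    exact sub_eq_zero.1 (hgc i)
  · have hSmem : S ∈ Ideal.span {a₁} := by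
      have hb : ∀ (k : ℕ) (x : R), b₁ ^ k * x ∈ Ideal.span {a₁} → x ∈ Ideal.span {a₁} := by
        intro k
        induction k with
        | zero => intro x hx; simpa using hx
        | succ k ih => intro x hx; exact ih x (hR.a₁_b₁ _ (by rwa [← mul_assoc, ← pow_succ']))
      refine hb t _ (Ideal.mem_span_singleton.2 ?_)
      have hlow : a₁ ^ (s - t) * a₁ ∣ ∑ j ∈ Finset.range t, T j := by
        refine Finset.dvd_sum fun j hj => Finset.dvd_sum fun i _ => ?_
        rw [← pow_succ, vertexLabel, mul_assoc, mul_assoc, mul_assoc]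
        refine Dvd.dvd.mul_right (pow_dvd_pow _ ?_) _
        have := Finset.mem_range.1 hj
        omega
      have h := (dvd_add_right hlow).1 (hT ▸ dvd_zero _)
      rw [hTt] at h
      exact (mul_dvd_mul_iff_left (pow_ne_zero _ hR.ne_a₁)).1 h
    obtain ⟨g, hg, hgc⟩ := exists_syzygy_of_sum_mem_of_support hR.a₁_a₂ hR.a₁_b₂
      hR.a₁_a₂_b₂ hts _ hft hfs hSmem
    have hgc' := fun i => Ideal.mem_span_singleton.1 (hgc i)
    choose h hh using hgc'
    refine ⟨g, h, hg, fun i hi => ?_, fun i => by rw [← hh i]; ring⟩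
    have h1 := hh i
    rw [hf _ (by simp; omega), hg i (by omega), hg (i + 1) (by omega)] at h1
    simpa [hR.ne_a₁] using h1

/-- Exactness at the vertices. The rows of a relation between the vertex labels are removed one
by one, starting from the top row. -/
theorem exists_edgeMap_eq (hR : IsRegularQuadruple a₁ a₂ b₁ b₂) (t : ℕ) (hts : t ≤ s + 1)
    (f : Bool × ℕ × ℕ → R) (hf : ∀ x ∉ cells s 1, f x = 0)
    (h0 : vertexMap a₁ a₂ b₁ b₂ s f = 0) (ht : ∀ x, t ≤ x.2.2 → f x = 0) :
    ∃ g, (∀ x ∉ cells s 2, g x = 0) ∧ edgeMap a₁ a₂ b₁ b₂ g = f := by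
  induction t generalizing f with
  | zero =>
    refine ⟨0, fun _ _ => rfl, ?_⟩
    rw [map_zero]
    funext x
    exact (ht x (Nat.zero_le _)).symm
  | succ t ih =>
    obtain ⟨u, v, hu, hv, huv⟩ := exists_row_eq hR (by omega) f hf h0 ht
    let g : Bool × ℕ × ℕ → R := fun x =>
      if x.2.2 = t then (if x.1 = false then u x.2.1 else v x.2.1) else 0
    have hg : ∀ x ∉ cells s 2, g x = 0 := by
      rintro ⟨b, i, j⟩ hx
      rw [mem_cells_two] at hx
      rcases eq_or_ne j t with rfl | hj
      · cases b with
        | false => simpa [g] using hu i (by simp at hx; omega)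
        | true => simpa [g] using hv i (by simp at hx; omega)
      · exact if_neg hj
    obtain ⟨g', hg', hgg'⟩ := ih (by omega) (f - edgeMap a₁ a₂ b₁ b₂ g)
      (fun x hx => by
        rw [Pi.sub_apply, hf x hx, zero_sub, neg_eq_zero]
        exact cellMap_support 1 g hg x hx)
      (by rw [map_sub, h0, vertexMap_edgeMap g hg, sub_zero]) (by
      rintro ⟨b, i, j⟩ hj
      cases b with
      | true =>
        simp only [mem_cells_one] at hf
        rw [Pi.sub_apply, edgeMap_true, sub_zero]
        exact hf _ (by simp)
      | false =>
        rw [Pi.sub_apply, edgeMap_false]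
        rcases (show t ≤ j from hj).eq_or_lt with rfl | hj
        · simp [g, huv]
        · rw [ht (false, i, j) (Nat.succ_le_of_lt hj)]
          simp [g, hj.ne', (Nat.lt_succ_of_lt hj).ne'])
    refine ⟨g + g', fun x hx => by rw [Pi.add_apply, hg x hx, hg' x hx, add_zero], ?_⟩
    rw [map_add, hgg', add_sub_cancel]

/-- The staircase complex is exact at all cells of dimension at least `0`. -/
theorem cellMap_exact (hR : IsRegularQuadruple a₁ a₂ b₁ b₂) (n : ℕ) (f : Bool × ℕ × ℕ → R)
    (hf : ∀ x ∉ cells s (n + 1), f x = 0) :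
    cellMap a₁ a₂ b₁ b₂ s n f = 0 ↔
      ∃ g, (∀ x ∉ cells s (n + 2), g x = 0) ∧ cellMap a₁ a₂ b₁ b₂ s (n + 1) g = f := by
  match n, hf with
  | 0, hf =>
    refine ⟨fun h => ?_, ?_⟩
    · refine exists_edgeMap_eq hR (s + 1) le_rfl f hf h fun x hx => hf x ?_
      rw [mem_cells_one]
      omega
    · rintro ⟨g, hg, rfl⟩
      exact vertexMap_edgeMap g hg
  | 1, hf =>
    refine ⟨fun h => ?_, ?_⟩
    · refine exists_squareMap_eq hR (s + 1) f hf h fun x hx => hf x ?_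
      rw [mem_cells_two]
      omega
    · rintro ⟨g, hg, rfl⟩
      exact edgeMap_squareMap g
  | 2, hf =>
    refine ⟨fun h => ⟨0, fun _ _ => rfl, ?_⟩, ?_⟩
    · rw [map_zero]
      exact (squareMap_injective hR f hf h).symm
    · rintro ⟨g, hg, rfl⟩
      exact map_zero _
  | n + 3, hf =>
    have h : f = 0 := funext fun x => hf x (Finset.notMem_empty x)
    exact ⟨fun _ => ⟨0, fun _ _ => rfl, by rw [map_zero, h]⟩, fun _ => rfl⟩

end Exactness

/-! ### Resolutions from maps of functions with prescribed support -/

section Supported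

variable {K : Type*} [Field K] {W : Type*} {τ : Type*} [DecidableEq τ]

/-- Extension by zero of a family indexed by an enumeration of the finite set `D`. -/
def extendZero (R : Type*) [CommRing R] (D : Finset τ) : (Fin D.card → R) →ₗ[R] (τ → R) :=
  LinearMap.pi fun x => if h : x ∈ D then LinearMap.proj (D.equivFin ⟨x, h⟩) else 0

theorem extendZero_of_notMem {R : Type*} [CommRing R] {D : Finset τ} (f : Fin D.card → R) :
    ∀ x ∉ D, extendZero R D f x = 0 := by
  intro x hx
  simp [extendZero, hx]

theorem extendZero_of_mem {R : Type*} [CommRing R] {D : Finset τ} (f : Fin D.card → R) {x : τ}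
    (h : x ∈ D) : extendZero R D f x = f (D.equivFin ⟨x, h⟩) := by
  simp [extendZero, h]

theorem extendZero_equivFin_symm {R : Type*} [CommRing R] {D : Finset τ} (f : Fin D.card → R)
    (b : Fin D.card) : extendZero R D f (D.equivFin.symm b) = f b := by
  rw [extendZero_of_mem f (D.equivFin.symm b).2]
  simp

/-- Restriction of a function to an enumeration of the finite set `D`. -/
def restrictTo (R : Type*) [CommRing R] (D : Finset τ) : (τ → R) →ₗ[R] (Fin D.card → R) :=
  LinearMap.funLeft R R fun b => (D.equivFin.symm b : τ)

theorem extendZero_restrictTo {R : Type*} [CommRing R] {D : Finset τ} {f : τ → R}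
    (hf : ∀ x ∉ D, f x = 0) : extendZero R D (restrictTo R D f) = f := by
  funext x
  by_cases h : x ∈ D
  · rw [extendZero_of_mem _ h]
    simp [restrictTo, LinearMap.funLeft_apply]
  · rw [extendZero_of_notMem _ x h, hf x h]

theorem restrictTo_extendZero {R : Type*} [CommRing R] {D : Finset τ} (f : Fin D.card → R) :
    restrictTo R D (extendZero R D f) = f :=
  funext fun b => extendZero_equivFin_symm f b

theorem extendZero_mem_ringDeg {D : Finset τ} {deg : τ → ℤ} {e : ℤ}
    {f : Fin D.card → MvPolynomial W K}
    (hf : f ∈ freeDeg K W (fun b => deg (D.equivFin.symm b)) e) (x : τ) :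
    extendZero _ D f x ∈ ringDeg K W (e - deg x) := by
  by_cases h : x ∈ D
  · rw [extendZero_of_mem _ h]
    simpa using mem_freeDeg.1 hf (D.equivFin ⟨x, h⟩)
  · rw [extendZero_of_notMem _ x h]
    exact zero_mem _

variable {M : Type*} [AddCommGroup M] [Module (MvPolynomial W K) M] {ℳ : ℤ → AddSubgroup M}

/-- The graded free resolution whose module in homological degree `n` consists of the functions on
`τ` supported in `D n`, with the basis vector at `x` in degree `deg n x`, and whose differentials
are given by the maps `P n`. -/
def resolutionOfSupported (D : ℕ → Finset τ) (deg : ℕ → τ → ℤ)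
    (P : ℕ → (τ → MvPolynomial W K) →ₗ[MvPolynomial W K] (τ → MvPolynomial W K))
    (aug : (Fin (D 0).card → MvPolynomial W K) →ₗ[MvPolynomial W K] M)
    (hsupp : ∀ n f, (∀ x ∉ D (n + 1), f x = 0) → ∀ x ∉ D n, P n f x = 0)
    (hdeg : ∀ n e f, (∀ x, f x ∈ ringDeg K W (e - deg (n + 1) x)) →
      ∀ x, P n f x ∈ ringDeg K W (e - deg n x))
    (hexact : ∀ n f, (∀ x ∉ D (n + 1), f x = 0) →
      (P n f = 0 ↔ ∃ g, (∀ x ∉ D (n + 2), g x = 0) ∧ P (n + 1) g = f))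
    (haug_deg : ∀ e, ∀ f ∈ freeDeg K W (fun b => deg 0 ((D 0).equivFin.symm b)) e, aug f ∈ ℳ e)
    (haug_surj : Function.Surjective aug)
    (haug_exact : ∀ f, aug f = 0 ↔
      ∃ g, (∀ x ∉ D 1, g x = 0) ∧ P 0 g = extendZero _ (D 0) f) :
    GradedFreeResolution K W ℳ where
  rank n := (D n).card
  shift n b := deg n ((D n).equivFin.symm b)
  d n := restrictTo _ (D n) ∘ₗ P n ∘ₗ extendZero _ (D (n + 1))
  aug := aug
  d_homogeneous n e _ hf :=
    mem_freeDeg.2 fun b => hdeg n e _ (extendZero_mem_ringDeg hf) ((D n).equivFin.symm b)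
  aug_homogeneous := haug_deg
  aug_surjective := haug_surj
  exact_aug f := by
    rw [haug_exact]
    constructor
    · rintro ⟨g, hg, h⟩
      refine ⟨restrictTo _ (D 1) g, ?_⟩
      simp only [LinearMap.comp_apply]
      rw [extendZero_restrictTo hg, h, restrictTo_extendZero]
    · rintro ⟨g, rfl⟩
      refine ⟨extendZero _ (D 1) g, extendZero_of_notMem g, ?_⟩
      exact (extendZero_restrictTo (hsupp 0 _ (extendZero_of_notMem g))).symm
  exact_d n f := by
    have h0 : (restrictTo _ (D n) ∘ₗ P n ∘ₗ extendZero _ (D (n + 1))) f = 0 ↔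
        P n (extendZero _ (D (n + 1)) f) = 0 := by
      simp only [LinearMap.comp_apply]
      refine ⟨fun h => ?_, fun h => by rw [h, map_zero]⟩
      rw [← extendZero_restrictTo (hsupp n _ (extendZero_of_notMem f)), h, map_zero]
    rw [h0, hexact n _ (extendZero_of_notMem f)]
    constructor
    · rintro ⟨g, hg, h⟩
      refine ⟨restrictTo _ (D (n + 2)) g, ?_⟩
      simp only [LinearMap.comp_apply]
      rw [extendZero_restrictTo hg, h, restrictTo_extendZero]
    · rintro ⟨g, rfl⟩
      refine ⟨extendZero _ (D (n + 2)) g, extendZero_of_notMem g, ?_⟩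
      exact (extendZero_restrictTo (hsupp (n + 1) _ (extendZero_of_notMem g))).symm

theorem mem_smul_top_of_forall_mem {R ι : Type*} [CommRing R] [Finite ι] {I : Ideal R}
    {f : ι → R} (hf : ∀ b, f b ∈ I) : f ∈ I • (⊤ : Submodule R (ι → R)) := by
  classical
  cases nonempty_fintype ι
  rw [pi_eq_sum_univ' f]
  exact sum_mem fun b _ => Submodule.smul_mem_smul (hf b) trivial

end Supported

/-! ### Projections for homogeneous ideals -/

section HomogeneousIdeal

variable {K : Type*} [Field K] {W : Type*}

theorem ringProj_mul_of_mem {d e : ℤ} {p q : MvPolynomial W K} (hq : q ∈ ringDeg K W e) :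
    ringProj d (p * q) = ringProj (d - e) p * q := by
  induction p using MvPolynomial.induction_on' with
  | monomial u c =>
    have hm := monomial_mem_ringDeg u c
    have hmul := mul_mem_ringDeg hm hq
    rcases eq_or_ne (u.degree : ℤ) (d - e) with h | h
    · rw [h] at hm hmul
      rw [sub_add_cancel] at hmul
      rw [ringProj_of_mem hm, ringProj_of_mem hmul]
    · rw [ringProj_of_mem_ne hm h.symm, zero_mul]
      exact ringProj_of_mem_ne hmul (by omega)
  | add p₁ p₂ h₁ h₂ => rw [add_mul, map_add, h₁, h₂, map_add, add_mul]

/-- An ideal generated by homogeneous elements contains the homogeneous components of its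
elements. -/
theorem ringProj_mem_span {S : Set (MvPolynomial W K)} (hS : ∀ p ∈ S, ∃ e, p ∈ ringDeg K W e)
    (d : ℤ) {p : MvPolynomial W K} (hp : p ∈ Ideal.span S) : ringProj d p ∈ Ideal.span S := by
  have key : ∀ r, ringProj d (r * p) ∈ Ideal.span S := by
    induction hp using Submodule.span_induction with
    | mem x hx =>
      obtain ⟨e, he⟩ := hS x hx
      intro r
      rw [ringProj_mul_of_mem he]
      exact Ideal.mul_mem_left _ _ (Ideal.subset_span hx)
    | zero => intro r; simp
    | add x y _ _ hx hy => intro r; rw [mul_add, map_add]; exact add_mem (hx r) (hy r)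
    | smul a x _ hx => intro r; rw [smul_eq_mul, ← mul_assoc]; exact hx _
  simpa using key 1

variable {I : Ideal (MvPolynomial W K)}

theorem hasProjections_idealDeg (hI : ∀ d, ∀ p ∈ I, ringProj d p ∈ I) :
    HasProjections (idealDeg I) := by
  refine ⟨fun e => AddMonoidHom.mk' (fun p => ⟨ringProj e p, hI e p p.2⟩) fun p q => ?_,
    fun e m hm => ⟨?_, fun e' he' => ?_⟩⟩
  · exact Subtype.ext (map_add _ _ _)
  · exact Subtype.ext (ringProj_of_mem hm)
  · exact Subtype.ext (ringProj_of_mem_ne hm he')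

theorem hasProjections_quotientDeg (hI : ∀ d, ∀ p ∈ I, ringProj d p ∈ I) :
    HasProjections (quotientDeg I) := by
  refine ⟨fun e => QuotientAddGroup.lift I.toAddSubgroup
    ((Ideal.Quotient.mk I).toAddMonoidHom.comp (ringProj e).toAddMonoidHom) fun p hp =>
      Ideal.Quotient.eq_zero_iff_mem.2 (hI e p hp), fun e m hm => ?_⟩
  obtain ⟨p, hp, rfl⟩ := hm
  refine ⟨?_, fun e' he' => ?_⟩
  · change Ideal.Quotient.mk I (ringProj e p) = Ideal.Quotient.mk I p
    rw [ringProj_of_mem hp]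
  · change Ideal.Quotient.mk I (ringProj e' p) = 0
    rw [ringProj_of_mem_ne hp he', map_zero]

end HomogeneousIdeal

/-! ### Products of variables -/

section Products

variable (K : Type*) [Field K] {W : Type*}

/-- The product of the variables in `U`. -/
def prodX (U : Finset W) : MvPolynomial W K := ∏ v ∈ U, MvPolynomial.X v

/-- The exponent of the monomial `prodX K U`. -/
def prodExp (U : Finset W) : W →₀ ℕ := ∑ v ∈ U, Finsupp.single v 1

variable {K}

theorem prodX_eq_monomial (U : Finset W) :
    prodX K U = MvPolynomial.monomial (prodExp U) 1 := by
  rw [prodX, prodExp, MvPolynomial.monomial_sum_one]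
  rfl

theorem prodX_ne_zero (U : Finset W) : prodX K U ≠ 0 :=
  Finset.prod_ne_zero_iff.2 fun v _ => MvPolynomial.X_ne_zero v

theorem prodX_mem_ringDeg (U : Finset W) : prodX K U ∈ ringDeg K W U.card := by
  have h := monomial_mem_ringDeg (prodExp U) (1 : K)
  rw [← prodX_eq_monomial] at h
  simpa [prodExp, map_sum] using h

theorem prodX_mem_irrelevant {U : Finset W} (hU : U.Nonempty) : prodX K U ∈ irrelevant K W := by
  obtain ⟨v, hv⟩ := hU
  exact Ideal.mem_of_dvd _ (Finset.dvd_prod_of_mem _ hv) (Ideal.subset_span ⟨v, rfl⟩)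

theorem prodX_dvd_prodX {U V : Finset W} (h : U ⊆ V) : prodX K U ∣ prodX K V :=
  Finset.prod_dvd_prod_of_subset _ _ _ h

theorem prodX_union [DecidableEq W] {U V : Finset W} (h : Disjoint U V) :
    prodX K (U ∪ V) = prodX K U * prodX K V :=
  Finset.prod_union h

theorem prodExp_apply [DecidableEq W] (U : Finset W) (w : W) :
    prodExp U w = if w ∈ U then 1 else 0 := by
  simp [prodExp, Finsupp.finsetSum_apply, Finsupp.single_apply]

/-- A product of variables is regular modulo an ideal generated by products of other variables. -/
theorem mem_span_of_prodX_mul_mem {S : Set (Finset W)} {V : Finset W}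
    (hS : ∀ U ∈ S, Disjoint U V) (p : MvPolynomial W K)
    (hp : prodX K V * p ∈ Ideal.span (prodX K '' S)) : p ∈ Ideal.span (prodX K '' S) := by
  classical
  have himage : prodX K '' S = (fun u => MvPolynomial.monomial u (1 : K)) '' (prodExp '' S) := by
    rw [Set.image_image]
    exact Set.image_congr fun U _ => prodX_eq_monomial U
  rw [himage, MvPolynomial.mem_ideal_span_monomial_image] at hp ⊢
  intro u hu
  obtain ⟨_, ⟨U, hU, rfl⟩, hle⟩ := hp (prodExp V + u) (by
    rw [MvPolynomial.mem_support_iff, prodX_eq_monomial, MvPolynomial.coeff_monomial_mul, one_mul]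
    exact MvPolynomial.mem_support_iff.1 hu)
  refine ⟨_, ⟨U, hU, rfl⟩, fun w => ?_⟩
  have h := hle w
  rw [Finsupp.add_apply, prodExp_apply, prodExp_apply] at h
  rw [prodExp_apply]
  split_ifs at h ⊢ with h1 h2
  · exact absurd h2 (Finset.disjoint_left.1 (hS U hU) h1)
  all_goals omega

theorem isRegularQuadruple_prodX {U₁ U₂ V₁ V₂ : Finset W} (hU : Disjoint U₁ U₂)
    (h11 : Disjoint U₁ V₁) (h12 : Disjoint U₁ V₂) (h22 : Disjoint U₂ V₂) :
    IsRegularQuadruple (prodX K U₁) (prodX K U₂) (prodX K V₁) (prodX K V₂) := by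
  have h1 : ∀ {U V : Finset W}, Disjoint U V → ∀ p : MvPolynomial W K,
      prodX K V * p ∈ Ideal.span {prodX K U} → p ∈ Ideal.span {prodX K U} := by
    intro U V h p hp
    rw [← Set.image_singleton] at hp ⊢
    exact mem_span_of_prodX_mul_mem (by simpa using h) p hp
  refine ⟨prodX_ne_zero _, prodX_ne_zero _, prodX_ne_zero _, h1 hU, h1 h11, h1 h12, h1 h22,
    fun p hp => ?_⟩
  rw [← Ideal.span_union, Set.singleton_union, ← Set.image_pair] at hp ⊢
  refine mem_span_of_prodX_mul_mem ?_ p hp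
  rintro U (rfl | rfl)
  · exact h12
  · exact h22

end Products

/-! ### Powers of the cover ideal -/

section Powers

/-- The powers of `(a₁ a₂, a₁ b₂, b₁ b₂)` are generated by the labels of the vertices. -/
theorem span_pow_eq_span_vertexLabel {R : Type*} [CommRing R] (a₁ a₂ b₁ b₂ : R) (s : ℕ) :
    Ideal.span {a₁ * a₂, a₁ * b₂, b₁ * b₂} ^ s =
      Ideal.span {p | ∃ i j, j ≤ i ∧ i ≤ s ∧ p = vertexLabel a₁ a₂ b₁ b₂ s i j} := by
  induction s with
  | zero =>
    rw [pow_zero, eq_comm, Ideal.one_eq_top, Ideal.eq_top_iff_one]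
    exact Ideal.subset_span ⟨0, 0, le_rfl, le_rfl, by simp [vertexLabel]⟩
  | succ s ih =>
    rw [pow_succ, ih, Ideal.span_mul_span']
    congr 1
    ext p
    constructor
    · rintro ⟨_, ⟨i, j, hji, his, rfl⟩, q, hq, rfl⟩
      rcases hq with rfl | rfl | rfl
      · refine ⟨i, j, hji, by omega, ?_⟩
        simp only [vertexLabel, Nat.succ_sub his, Nat.succ_sub (hji.trans his), pow_succ]
        ring
      · refine ⟨i + 1, j, by omega, by omega, ?_⟩
        simp only [vertexLabel, Nat.add_sub_add_right, Nat.succ_sub (hji.trans his), pow_succ]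
        ring
      · refine ⟨i + 1, j + 1, by omega, by omega, ?_⟩
        simp only [vertexLabel, Nat.add_sub_add_right, pow_succ]
        ring
    · rintro ⟨i, j, hji, his, rfl⟩
      rcases Nat.lt_or_ge s i with hi | hi
      · obtain rfl : i = s + 1 := by omega
        rcases Nat.lt_or_ge s j with hj | hj
        · obtain rfl : j = s + 1 := by omega
          refine ⟨_, ⟨s, s, le_rfl, le_rfl, rfl⟩, b₁ * b₂, by simp, ?_⟩
          simp only [vertexLabel, Nat.sub_self, pow_succ]
          ring
        · refine ⟨_, ⟨s, j, hj, le_rfl, rfl⟩, a₁ * b₂, by simp, ?_⟩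
          simp only [vertexLabel, Nat.sub_self, Nat.succ_sub hj, pow_succ]
          ring
      · refine ⟨_, ⟨i, j, hji, hi, rfl⟩, a₁ * a₂, by simp, ?_⟩
        simp only [vertexLabel, Nat.succ_sub hi, Nat.succ_sub (hji.trans hi), pow_succ]
        ring

theorem mem_span_vertexLabel_iff {R : Type*} [CommRing R] {a₁ a₂ b₁ b₂ : R} {s : ℕ} {p : R} :
    p ∈ Ideal.span {p | ∃ i j, j ≤ i ∧ i ≤ s ∧ p = vertexLabel a₁ a₂ b₁ b₂ s i j} ↔
      ∃ f, (∀ x ∉ cells s 1, f x = 0) ∧ vertexMap a₁ a₂ b₁ b₂ s f (false, 0, 0) = p := by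
  constructor
  · intro hp
    induction hp using Submodule.span_induction with
    | mem p hp =>
      obtain ⟨i, j, hji, his, rfl⟩ := hp
      refine ⟨Pi.single (false, i, j) 1, fun x hx => Pi.single_eq_of_ne ?_ _, ?_⟩
      · rintro rfl
        exact hx (mem_cells_one.2 ⟨rfl, hji, his⟩)
      · rw [vertexMap_apply, Finset.sum_eq_single j, Finset.sum_eq_single i]
        · simp
        · intro i' _ hi'
          rw [Pi.single_eq_of_ne (by simp [hi']), mul_zero]
        · intro h
          exact absurd (Finset.mem_range_succ_iff.2 his) h
        · intro j' _ hj'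
          refine Finset.sum_eq_zero fun i' _ => ?_
          rw [Pi.single_eq_of_ne (by simp [hj']), mul_zero]
        · intro h
          exact absurd (Finset.mem_range_succ_iff.2 (hji.trans his)) h
    | zero => exact ⟨0, fun _ _ => rfl, by simp⟩
    | add p q _ _ hp hq =>
      obtain ⟨f, hf, rfl⟩ := hp
      obtain ⟨g, hg, rfl⟩ := hq
      exact ⟨f + g, fun x hx => by rw [Pi.add_apply, hf x hx, hg x hx, add_zero], by simp⟩
    | smul a p _ hp =>
      obtain ⟨f, hf, rfl⟩ := hp
      exact ⟨a • f, fun x hx => by rw [Pi.smul_apply, hf x hx, smul_zero], by simp⟩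
  · rintro ⟨f, hf, rfl⟩
    rw [vertexMap_apply]
    refine sum_mem fun j _ => sum_mem fun i hi => ?_
    by_cases h : j ≤ i
    · exact Ideal.mul_mem_right _ _
        (Ideal.subset_span ⟨i, j, h, Finset.mem_range_succ_iff.1 hi, rfl⟩)
    · rw [hf _ (by rw [mem_cells_one]; simp; omega), mul_zero]
      exact zero_mem _

theorem completeBipartiteOn_adj {W : Type*} {A B : Finset W} (h : Disjoint A B) {v w : W} :
    (completeBipartiteOn A B).Adj v w ↔ (v ∈ A ∧ w ∈ B) ∨ (w ∈ A ∧ v ∈ B) := by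
  rw [completeBipartiteOn, SimpleGraph.fromRel_adj]
  refine ⟨fun h => h.2, fun h' => ⟨?_, h'⟩⟩
  rintro rfl
  rcases h' with h' | h' <;> exact Finset.disjoint_left.1 h h'.1 h'.2

/-- The minimal vertex covers of the graph are `U₁ ∪ U₂`, `U₁ ∪ V₂` and `V₁ ∪ V₂`. -/
theorem coverIdeal_eq_span {K : Type*} [Field K] {W : Type*} [DecidableEq W] {U₁ U₂ V₁ V₂ : Finset W}
    (hU : Disjoint U₁ U₂) (hV : Disjoint V₁ V₂) (hUV : Disjoint (U₁ ∪ U₂) (V₁ ∪ V₂)) :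
    coverIdeal K (completeBipartiteOn U₁ (V₁ ∪ V₂) ⊔ completeBipartiteOn U₂ V₂) =
      Ideal.span {prodX K U₁ * prodX K U₂, prodX K U₁ * prodX K V₂, prodX K V₁ * prodX K V₂} := by
  have hd1 : Disjoint U₁ (V₁ ∪ V₂) := hUV.mono_left Finset.subset_union_left
  have hd2 : Disjoint U₂ V₂ := hUV.mono Finset.subset_union_right Finset.subset_union_right
  have hd12 : Disjoint U₁ V₂ := hd1.mono_right Finset.subset_union_right
  rw [← prodX_union hU, ← prodX_union hd12, ← prodX_union hV]
  have hcover : ∀ C : Finset W,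
      (completeBipartiteOn U₁ (V₁ ∪ V₂) ⊔ completeBipartiteOn U₂ V₂).IsVertexCover (C : Set W) ↔
      (∀ u ∈ U₁, ∀ v ∈ V₁ ∪ V₂, u ∈ C ∨ v ∈ C) ∧ ∀ u ∈ U₂, ∀ v ∈ V₂, u ∈ C ∨ v ∈ C := by
    intro C
    simp only [SimpleGraph.IsVertexCover, SimpleGraph.sup_adj, completeBipartiteOn_adj hd1,
      completeBipartiteOn_adj hd2, Finset.mem_coe]
    grind
  apply le_antisymm
  · refine Ideal.span_le.2 ?_
    rintro _ ⟨C, hC, rfl⟩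
    rw [hcover] at hC
    have hsub : U₁ ∪ U₂ ⊆ C ∨ U₁ ∪ V₂ ⊆ C ∨ V₁ ∪ V₂ ⊆ C := by
      by_cases h1 : U₁ ⊆ C
      · by_cases h2 : U₂ ⊆ C
        · exact Or.inl (Finset.union_subset h1 h2)
        · obtain ⟨u, hu, huC⟩ := Finset.not_subset.1 h2
          exact Or.inr (Or.inl (Finset.union_subset h1 fun v hv =>
            (hC.2 u hu v hv).resolve_left huC))
      · obtain ⟨u, hu, huC⟩ := Finset.not_subset.1 h1
        exact Or.inr (Or.inr fun v hv => (hC.1 u hu v hv).resolve_left huC)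
    rcases hsub with h | h | h
    · exact Ideal.mem_of_dvd _ (prodX_dvd_prodX h) (Ideal.subset_span (by simp))
    · exact Ideal.mem_of_dvd _ (prodX_dvd_prodX h) (Ideal.subset_span (by simp))
    · exact Ideal.mem_of_dvd _ (prodX_dvd_prodX h) (Ideal.subset_span (by simp))
  · refine Ideal.span_le.2 ?_
    rintro _ (rfl | rfl | rfl)
    all_goals
      refine Ideal.subset_span ⟨_, (hcover _).2 ?_, rfl⟩
      grind

end Powers

/-! ### Number and degrees of the cells -/

section Cells

/-- The pairs `(i, j)` with `j < i < n`. -/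
def triangle (n : ℕ) : Finset (Σ _ : ℕ, ℕ) := (Finset.range n).sigma fun i => Finset.range i

theorem mem_triangle {n : ℕ} {x : Σ _ : ℕ, ℕ} : x ∈ triangle n ↔ x.1 < n ∧ x.2 < x.1 := by
  simp [triangle]

theorem card_triangle (n : ℕ) : (triangle n).card = n.choose 2 := by
  simp [triangle, Finset.card_sigma, Finset.sum_range_id, Nat.choose_two_right]

theorem card_cells_one (s : ℕ) : (cells s 1).card = (s + 2).choose 2 := by
  rw [← card_triangle]
  refine Finset.card_bij' (fun x _ => ⟨x.2.1 + 1, x.2.2⟩) (fun x _ => (false, x.1 - 1, x.2))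
    ?_ ?_ ?_ ?_
  · intro x hx
    rw [mem_cells_one] at hx
    rw [mem_triangle]
    dsimp only
    omega
  · intro x hx
    rw [mem_triangle] at hx
    rw [mem_cells_one]
    exact ⟨rfl, by dsimp only; omega, by dsimp only; omega⟩
  · rintro ⟨t, i, j⟩ hx
    rw [mem_cells_one] at hx
    simp [hx.1.symm]
  · rintro ⟨i, j⟩ hx
    rw [mem_triangle] at hx
    dsimp only at hx ⊢
    rw [Nat.sub_add_cancel (by omega)]

theorem card_cells_two (s : ℕ) : (cells s 2).card = 2 * (s + 1).choose 2 := by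
  rw [← card_triangle, two_mul, ← Finset.card_filter_add_card_filter_not (fun x => x.1 = false)]
  congr 1
  · refine Finset.card_bij' (fun x _ => ⟨x.2.1, x.2.2⟩) (fun x _ => (false, x.1, x.2))
      ?_ ?_ ?_ ?_
    · intro x hx
      rw [Finset.mem_filter, mem_cells_two] at hx
      rw [mem_triangle]
      grind
    · intro x hx
      rw [mem_triangle] at hx
      rw [Finset.mem_filter, mem_cells_two]
      grind
    · rintro ⟨t, i, j⟩ hx
      rw [Finset.mem_filter] at hx
      simp [hx.2.symm]
    · intro x _
      rfl
  · refine Finset.card_bij' (fun x _ => ⟨x.2.1, x.2.2 - 1⟩) (fun x _ => (true, x.1, x.2 + 1))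
      ?_ ?_ ?_ ?_
    · intro x hx
      rw [Finset.mem_filter, mem_cells_two] at hx
      rw [mem_triangle]
      grind
    · intro x hx
      rw [mem_triangle] at hx
      rw [Finset.mem_filter, mem_cells_two]
      grind
    · rintro ⟨t, i, j⟩ hx
      rw [Finset.mem_filter, mem_cells_two] at hx
      grind
    · intro x _
      rfl

theorem card_cells_three (s : ℕ) : (cells s 3).card = s.choose 2 := by
  rw [← card_triangle]
  refine Finset.card_bij' (fun x _ => ⟨x.2.1 - 1, x.2.2 - 1⟩)
    (fun x _ => (false, x.1 + 1, x.2 + 1)) ?_ ?_ ?_ ?_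
  · intro x hx
    rw [mem_cells_three] at hx
    rw [mem_triangle]
    dsimp only
    omega
  · intro x hx
    rw [mem_triangle] at hx
    rw [mem_cells_three]
    grind
  · rintro ⟨t, i, j⟩ hx
    rw [mem_cells_three] at hx
    grind
  · intro x _
    rfl

/-- The degrees of the basis vectors of the staircase complex, where `a₁, a₂, b₁, b₂` have the
degrees `n₁, n₂, m₁, m₂`. -/
def cellDeg (n₁ n₂ m₁ m₂ : ℤ) (s : ℕ) : ℕ → Bool × ℕ × ℕ → ℤ
  | 1, x => (s - x.2.2) * n₁ + (s - x.2.1) * n₂ + x.2.2 * m₁ + x.2.1 * m₂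
  | 2, x => if x.1 = false then
      (s - x.2.2) * n₁ + (s - x.2.1 + 1) * n₂ + x.2.2 * m₁ + x.2.1 * m₂
    else (s - x.2.2 + 1) * n₁ + (s - x.2.1) * n₂ + x.2.2 * m₁ + x.2.1 * m₂
  | 3, x => (s - x.2.2 + 1) * n₁ + (s - x.2.1 + 1) * n₂ + x.2.2 * m₁ + x.2.1 * m₂
  | _, _ => 0

/-- The values `degree - homological degree` which belong to the cells. -/
theorem exists_cellDeg_iff (n₁ n₂ m₁ m₂ : ℤ) (s : ℕ) (q : ℤ) :
    (∃ n, ∃ x ∈ cells s (n + 1), q = cellDeg n₁ n₂ m₁ m₂ s (n + 1) x - n) ↔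
      q ∈ ({q : ℤ | ∃ i j : ℕ, j ≤ i ∧ i ≤ s ∧
            q = (s - j) * n₁ + (s - i) * n₂ + j * m₁ + i * m₂} ∪
          {q : ℤ | ∃ i j : ℕ, j < i ∧ i ≤ s ∧
            q = (s - j) * n₁ + (s - i) * n₂ + (j + 1) * m₁ + i * m₂ - 1} ∪
          {q : ℤ | ∃ i j : ℕ, j < i ∧ i ≤ s ∧
            q = (s - j) * n₁ + (s - i + 1) * n₂ + j * m₁ + i * m₂ - 1} ∪
          {q : ℤ | ∃ i j : ℕ, j < i ∧ i < s ∧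
            q = (s - j) * n₁ + (s - i) * n₂ + (j + 1) * m₁ + (i + 1) * m₂ - 2} : Set ℤ) := by
  constructor
  · rintro ⟨n, ⟨t, i, j⟩, hx, rfl⟩
    match n, hx with
    | 0, hx =>
      obtain ⟨-, hji, his⟩ := mem_cells_one.1 hx
      exact Or.inl (Or.inl (Or.inl ⟨i, j, hji, his, by simp [cellDeg]⟩))
    | 1, hx =>
      obtain ⟨⟨rfl, hji⟩ | ⟨rfl, hj, hji⟩, his⟩ := mem_cells_two.1 hx
      · exact Or.inl (Or.inr ⟨i, j, hji, his, by simp [cellDeg]⟩)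
      · obtain ⟨k, rfl⟩ := Nat.exists_eq_add_of_le' hj
        refine Or.inl (Or.inl (Or.inr ⟨i, k, hji, his, ?_⟩))
        simp only [cellDeg, Bool.true_eq_false, if_false]
        push_cast
        ring
    | 2, hx =>
      obtain ⟨-, hj, hji, his⟩ := mem_cells_three.1 hx
      dsimp only at hj hji his
      obtain ⟨k, rfl⟩ := Nat.exists_eq_add_of_le' hj
      obtain ⟨l, rfl⟩ := Nat.exists_eq_add_of_le' (show 1 ≤ i by omega)
      refine Or.inr ⟨l, k, by omega, by omega, ?_⟩
      simp only [cellDeg]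
      push_cast
      ring
    | n + 3, hx => exact absurd hx (Finset.notMem_empty _)
  · rintro (((⟨i, j, hji, his, rfl⟩ | ⟨i, j, hji, his, rfl⟩) | ⟨i, j, hji, his, rfl⟩) |
      ⟨i, j, hji, his, rfl⟩)
    · exact ⟨0, (false, i, j), mem_cells_one.2 ⟨rfl, hji, his⟩, by simp [cellDeg]⟩
    · refine ⟨1, (true, i, j + 1), mem_cells_two.2 ⟨Or.inr ⟨rfl, by simp, hji⟩, his⟩, ?_⟩
      simp only [cellDeg, Bool.true_eq_false, if_false]
      push_cast
      ring
    · exact ⟨1, (false, i, j), mem_cells_two.2 ⟨Or.inl ⟨rfl, hji⟩, his⟩, by simp [cellDeg]⟩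
    · refine ⟨2, (false, i + 1, j + 1), mem_cells_three.2
        ⟨rfl, by simp, Nat.succ_lt_succ hji, his⟩, ?_⟩
      simp only [cellDeg]
      push_cast
      ring

end Cells

/-! ### The staircase resolution -/

section Staircase

variable {K : Type*} [Field K] {W : Type*}

theorem mul_mem_ringDeg_of_eq {p q : MvPolynomial W K} {c d e : ℤ} (hp : p ∈ ringDeg K W c)
    (hq : q ∈ ringDeg K W d) (h : c + d = e) : p * q ∈ ringDeg K W e :=
  h ▸ mul_mem_ringDeg hp hq

theorem pow_mem_ringDeg {p : MvPolynomial W K} {d : ℤ} (hp : p ∈ ringDeg K W d) (k : ℕ) :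
    p ^ k ∈ ringDeg K W (k * d) := by
  induction k with
  | zero => simpa using monomial_mem_ringDeg (0 : W →₀ ℕ) (1 : K)
  | succ k ih =>
    rw [pow_succ]
    exact mul_mem_ringDeg_of_eq ih hp (by push_cast; ring)

variable {a₁ a₂ b₁ b₂ : MvPolynomial W K} {n₁ n₂ m₁ m₂ : ℤ} {s : ℕ}

theorem vertexLabel_mem_ringDeg (ha₁ : a₁ ∈ ringDeg K W n₁) (ha₂ : a₂ ∈ ringDeg K W n₂)
    (hb₁ : b₁ ∈ ringDeg K W m₁) (hb₂ : b₂ ∈ ringDeg K W m₂) {i j : ℕ} (hi : i ≤ s) (hj : j ≤ s) :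
    vertexLabel a₁ a₂ b₁ b₂ s i j ∈ ringDeg K W
      ((s - j) * n₁ + (s - i) * n₂ + j * m₁ + i * m₂) := by
  have h := mul_mem_ringDeg (mul_mem_ringDeg (mul_mem_ringDeg (pow_mem_ringDeg ha₁ (s - j))
    (pow_mem_ringDeg ha₂ (s - i))) (pow_mem_ringDeg hb₁ j)) (pow_mem_ringDeg hb₂ i)
  rwa [Nat.cast_sub hi, Nat.cast_sub hj] at h

theorem vertexMap_apply_mem_ringDeg (ha₁ : a₁ ∈ ringDeg K W n₁) (ha₂ : a₂ ∈ ringDeg K W n₂)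
    (hb₁ : b₁ ∈ ringDeg K W m₁) (hb₂ : b₂ ∈ ringDeg K W m₂) {e : ℤ}
    {f : Bool × ℕ × ℕ → MvPolynomial W K}
    (hf : ∀ x, f x ∈ ringDeg K W (e - cellDeg n₁ n₂ m₁ m₂ s 1 x)) :
    vertexMap a₁ a₂ b₁ b₂ s f (false, 0, 0) ∈ ringDeg K W e := by
  rw [vertexMap_apply]
  refine sum_mem fun j hj => sum_mem fun i hi => ?_
  rw [Finset.mem_range_succ_iff] at hi hj
  refine mul_mem_ringDeg_of_eq (vertexLabel_mem_ringDeg ha₁ ha₂ hb₁ hb₂ hi hj)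
    (hf (false, i, j)) ?_
  simp only [cellDeg]
  ring

/-- The differentials of the staircase complex are homogeneous of degree `0`. -/
theorem cellMap_mem_ringDeg (ha₁ : a₁ ∈ ringDeg K W n₁) (ha₂ : a₂ ∈ ringDeg K W n₂)
    (hb₁ : b₁ ∈ ringDeg K W m₁) (hb₂ : b₂ ∈ ringDeg K W m₂) (n : ℕ) (e : ℤ)
    (f : Bool × ℕ × ℕ → MvPolynomial W K)
    (hf : ∀ x, f x ∈ ringDeg K W (e - cellDeg n₁ n₂ m₁ m₂ s (n + 1) x)) (x : Bool × ℕ × ℕ) :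
    cellMap a₁ a₂ b₁ b₂ s n f x ∈ ringDeg K W (e - cellDeg n₁ n₂ m₁ m₂ s n x) := by
  match n, hf with
  | 0, hf =>
    rcases eq_or_ne x (false, 0, 0) with rfl | hx
    · rw [cellDeg, sub_zero]
      · exact vertexMap_apply_mem_ringDeg ha₁ ha₂ hb₁ hb₂ hf
      all_goals simp
    · rw [cellMap, vertexMap_apply_of_ne f hx]
      exact zero_mem _
  | 1, hf =>
    obtain ⟨t, i, j⟩ := x
    cases t with
    | true =>
      rw [cellMap, edgeMap_true]
      exact zero_mem _
    | false =>
      rw [cellMap, edgeMap_false]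
      refine sub_mem (add_mem (sub_mem
        (mul_mem_ringDeg_of_eq ha₂ (hf _) ?_) (mul_mem_ringDeg_of_eq hb₂ (hf _) ?_))
        (mul_mem_ringDeg_of_eq ha₁ (hf _) ?_)) (mul_mem_ringDeg_of_eq hb₁ (hf _) ?_)
      all_goals
        simp only [cellDeg, Bool.true_eq_false, if_true, if_false]
        push_cast
        ring
  | 2, hf =>
    obtain ⟨t, i, j⟩ := x
    cases t with
    | true =>
      rw [cellMap, squareMap_true]
      refine sub_mem (mul_mem_ringDeg_of_eq hb₂ (hf _) ?_) (mul_mem_ringDeg_of_eq ha₂ (hf _) ?_)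
      all_goals
        simp only [cellDeg, Bool.true_eq_false, if_false]
        push_cast
        ring
    | false =>
      rw [cellMap, squareMap_false]
      refine sub_mem (mul_mem_ringDeg_of_eq ha₁ (hf _) ?_) (mul_mem_ringDeg_of_eq hb₁ (hf _) ?_)
      all_goals
        simp only [cellDeg, if_true]
        push_cast
        ring
  | n + 3, _ => exact zero_mem _

/-- The staircase complex is minimal: the entries of its differentials lie in the homogeneous
maximal ideal. At the vertices, this requires `1 ≤ s`. -/
theorem cellMap_mem_irrelevant (ha₁ : a₁ ∈ irrelevant K W) (ha₂ : a₂ ∈ irrelevant K W)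
    (hb₁ : b₁ ∈ irrelevant K W) (hb₂ : b₂ ∈ irrelevant K W) (hs : 1 ≤ s) (n : ℕ)
    (f : Bool × ℕ × ℕ → MvPolynomial W K) (x : Bool × ℕ × ℕ) :
    cellMap a₁ a₂ b₁ b₂ s n f x ∈ irrelevant K W := by
  have hmul : ∀ {p : MvPolynomial W K}, p ∈ irrelevant K W → ∀ q, p * q ∈ irrelevant K W :=
    fun hp q => Ideal.mul_mem_right q _ hp
  match n with
  | 0 =>
    rcases eq_or_ne x (false, 0, 0) with rfl | hx
    · rw [cellMap, vertexMap_apply]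
      refine sum_mem fun j _ => sum_mem fun i _ => hmul ?_ _
      rcases Nat.eq_zero_or_pos i with rfl | hi
      · refine hmul (hmul (Ideal.mul_mem_left _ _ ?_) _) _
        exact Ideal.pow_mem_of_mem _ ha₂ _ (by omega)
      · exact Ideal.mul_mem_left _ _ (Ideal.pow_mem_of_mem _ hb₂ _ hi)
    · rw [cellMap, vertexMap_apply_of_ne f hx]
      exact zero_mem _
  | 1 =>
    obtain ⟨t, i, j⟩ := x
    cases t with
    | true =>
      rw [cellMap, edgeMap_true]
      exact zero_mem _
    | false =>
      rw [cellMap, edgeMap_false]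
      exact sub_mem (add_mem (sub_mem (hmul ha₂ _) (hmul hb₂ _)) (hmul ha₁ _)) (hmul hb₁ _)
  | 2 =>
    obtain ⟨t, i, j⟩ := x
    cases t with
    | true =>
      rw [cellMap, squareMap_true]
      exact sub_mem (hmul hb₂ _) (hmul ha₂ _)
    | false =>
      rw [cellMap, squareMap_false]
      exact sub_mem (hmul ha₁ _) (hmul hb₁ _)
  | n + 3 => exact zero_mem _

/-- The staircase complex, with the ring in homological degree `0`, is a minimal graded free
resolution of the quotient by the ideal of the vertex labels. -/
theorem exists_minimal_resolution_quotient (hR : IsRegularQuadruple a₁ a₂ b₁ b₂)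
    (ha₁ : a₁ ∈ ringDeg K W n₁) (ha₂ : a₂ ∈ ringDeg K W n₂)
    (hb₁ : b₁ ∈ ringDeg K W m₁) (hb₂ : b₂ ∈ ringDeg K W m₂)
    (hmin : ∀ n f x, cellMap a₁ a₂ b₁ b₂ s n f x ∈ irrelevant K W)
    {I : Ideal (MvPolynomial W K)}
    (hI : I = Ideal.span {p | ∃ i j, j ≤ i ∧ i ≤ s ∧ p = vertexLabel a₁ a₂ b₁ b₂ s i j}) :
    ∃ F : GradedFreeResolution K W (quotientDeg I), F.IsMinimal ∧
      ∀ n, F.rank n = (cells s n).card := by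
  let pt : Bool × ℕ × ℕ := (false, 0, 0)
  have hpt : pt ∈ cells s 0 := mem_cells_zero.2 rfl
  refine ⟨resolutionOfSupported (cells s) (cellDeg n₁ n₂ m₁ m₂ s) (cellMap a₁ a₂ b₁ b₂ s)
    (I.mkQ ∘ₗ LinearMap.proj pt ∘ₗ extendZero _ (cells s 0))
    cellMap_support (cellMap_mem_ringDeg ha₁ ha₂ hb₁ hb₂) (cellMap_exact hR) ?_ ?_ ?_,
    fun n => ?_, fun n => rfl⟩
  · intro e f hf
    refine ⟨_, ?_, rfl⟩
    have h := extendZero_mem_ringDeg hf pt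
    rwa [cellDeg, sub_zero] at h
    all_goals simp
  · intro m
    obtain ⟨p, rfl⟩ := Ideal.Quotient.mk_surjective m
    refine ⟨restrictTo _ _ (Pi.single pt p), ?_⟩
    simp only [LinearMap.comp_apply]
    rw [extendZero_restrictTo]
    · rw [LinearMap.proj_apply, Pi.single_eq_same]
      rfl
    · intro x hx
      exact Pi.single_eq_of_ne (fun h => hx (mem_cells_zero.2 h)) _
  · intro f
    have h0 : (I.mkQ ∘ₗ LinearMap.proj pt ∘ₗ extendZero _ (cells s 0)) f = 0 ↔
        extendZero _ (cells s 0) f pt ∈ I := Ideal.Quotient.eq_zero_iff_mem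
    rw [h0, hI, mem_span_vertexLabel_iff]
    refine exists_congr fun g => and_congr_right fun _ => ⟨fun h => ?_, fun h => congrFun h pt⟩
    funext x
    rcases eq_or_ne x pt with rfl | hx
    · exact h
    · rw [extendZero_of_notMem f x fun h => hx (mem_cells_zero.1 h)]
      exact vertexMap_apply_of_ne g hx
  · rintro _ ⟨f, rfl⟩
    exact mem_smul_top_of_forall_mem fun b => hmin n _ _

/-- The staircase complex is a minimal graded free resolution of the ideal of the vertex labels. -/
theorem exists_minimal_resolution_ideal (hR : IsRegularQuadruple a₁ a₂ b₁ b₂)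
    (ha₁ : a₁ ∈ ringDeg K W n₁) (ha₂ : a₂ ∈ ringDeg K W n₂)
    (hb₁ : b₁ ∈ ringDeg K W m₁) (hb₂ : b₂ ∈ ringDeg K W m₂)
    (hmin : ∀ n f x, cellMap a₁ a₂ b₁ b₂ s n f x ∈ irrelevant K W)
    {I : Ideal (MvPolynomial W K)}
    (hI : I = Ideal.span {p | ∃ i j, j ≤ i ∧ i ≤ s ∧ p = vertexLabel a₁ a₂ b₁ b₂ s i j}) :
    ∃ F : GradedFreeResolution K W (idealDeg I), F.IsMinimal ∧
      ∀ n j, (∃ b, F.shift n b = j) ↔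
        ∃ x ∈ cells s (n + 1), cellDeg n₁ n₂ m₁ m₂ s (n + 1) x = j := by
  let pt : Bool × ℕ × ℕ := (false, 0, 0)
  have hmem : ∀ f, (LinearMap.proj pt ∘ₗ vertexMap a₁ a₂ b₁ b₂ s ∘ₗ
      extendZero (MvPolynomial W K) (cells s 1)) f ∈ I := fun f => by
    rw [hI]
    exact mem_span_vertexLabel_iff.2 ⟨_, extendZero_of_notMem f, rfl⟩
  refine ⟨resolutionOfSupported (fun n => cells s (n + 1))
    (fun n => cellDeg n₁ n₂ m₁ m₂ s (n + 1)) (fun n => cellMap a₁ a₂ b₁ b₂ s (n + 1))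
    (LinearMap.codRestrict I _ hmem)
    (fun n => cellMap_support (n + 1)) (fun n => cellMap_mem_ringDeg ha₁ ha₂ hb₁ hb₂ (n + 1))
    (fun n => cellMap_exact hR (n + 1)) ?_ ?_ ?_, fun n => ?_, fun n j => ?_⟩
  · intro e f hf
    exact vertexMap_apply_mem_ringDeg ha₁ ha₂ hb₁ hb₂ (extendZero_mem_ringDeg hf)
  · rintro ⟨p, hp⟩
    obtain ⟨f, hf, h⟩ := mem_span_vertexLabel_iff.1 (hI ▸ hp)
    refine ⟨restrictTo _ _ f, Subtype.ext ?_⟩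
    simp only [LinearMap.codRestrict_apply, LinearMap.comp_apply]
    rw [extendZero_restrictTo hf]
    exact h
  · intro f
    rw [← cellMap_exact hR 0 _ (extendZero_of_notMem f), Subtype.ext_iff]
    refine ⟨fun h => ?_, fun h => congrFun h pt⟩
    funext x
    rcases eq_or_ne x pt with rfl | hx
    · exact h
    · exact vertexMap_apply_of_ne _ hx
  · rintro _ ⟨f, rfl⟩
    exact mem_smul_top_of_forall_mem fun b => hmin (n + 1) _ _
  · constructor
    · rintro ⟨b, rfl⟩
      exact ⟨_, ((cells s (n + 1)).equivFin.symm b).2, rfl⟩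
    · rintro ⟨x, hx, rfl⟩
      refine ⟨(cells s (n + 1)).equivFin ⟨x, hx⟩, ?_⟩
      simp [resolutionOfSupported]

/-- The regularity of a graded module which has a minimal graded free resolution with the basis of
the staircase complex is the greatest value `degree - homological degree` of a cell. -/
theorem hasRegularity_of_shift_iff {M : Type*} [AddCommGroup M] [Module (MvPolynomial W K) M]
    {ℳ : ℤ → AddSubgroup M} (hℳ : HasProjections ℳ) (F : GradedFreeResolution K W ℳ)
    (hF : F.IsMinimal)
    (hshift : ∀ n j, (∃ b, F.shift n b = j) ↔
      ∃ x ∈ cells s (n + 1), cellDeg n₁ n₂ m₁ m₂ s (n + 1) x = j) {r : ℤ}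
    (hr : IsGreatest {q : ℤ | ∃ n, ∃ x ∈ cells s (n + 1),
      q = cellDeg n₁ n₂ m₁ m₂ s (n + 1) x - n} r) :
    HasRegularity K W ℳ r := by
  refine ⟨⟨F⟩, fun F' => ?_⟩
  convert hr using 1
  ext q
  simp only [Set.mem_ofPred_eq, GradedFreeResolution.torDeg_ne_bot_iff hℳ F' F,
    hF.torDeg_ne_bot_iff, hshift]
  constructor
  · rintro ⟨n, _, ⟨x, hx, rfl⟩, rfl⟩
    exact ⟨n, x, hx, rfl⟩
  · rintro ⟨n, x, hx, rfl⟩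
    exact ⟨n, _, ⟨x, hx, rfl⟩, rfl⟩

theorem exists_isGreatest_cellDeg (n₁ n₂ m₁ m₂ : ℤ) (s : ℕ) :
    ∃ r, IsGreatest {q : ℤ | ∃ n, ∃ x ∈ cells s (n + 1),
      q = cellDeg n₁ n₂ m₁ m₂ s (n + 1) x - n} r := by
  let E : Finset ℤ := (Finset.range 3).biUnion fun n =>
    (cells s (n + 1)).image fun x => cellDeg n₁ n₂ m₁ m₂ s (n + 1) x - n
  have hE : {q : ℤ | ∃ n, ∃ x ∈ cells s (n + 1),
      q = cellDeg n₁ n₂ m₁ m₂ s (n + 1) x - n} = (E : Set ℤ) := by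
    ext q
    simp only [Set.mem_ofPred_eq, E, Finset.mem_coe, Finset.mem_biUnion, Finset.mem_range,
      Finset.mem_image]
    constructor
    · rintro ⟨n, x, hx, rfl⟩
      refine ⟨n, ?_, x, hx, rfl⟩
      by_contra! hn
      obtain ⟨k, rfl⟩ := Nat.exists_eq_add_of_le' hn
      exact Finset.notMem_empty x hx
    · rintro ⟨n, -, x, hx, rfl⟩
      exact ⟨n, x, hx, rfl⟩
  have hne : E.Nonempty := by
    refine Finset.coe_nonempty.1 (hE ▸ ?_)
    exact ⟨_, 0, (false, 0, 0), mem_cells_one.2 ⟨rfl, le_rfl, Nat.zero_le _⟩, rfl⟩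
  rw [hE]
  exact ⟨E.max' hne, E.isGreatest_max' hne⟩

end Staircase

end CoverIdealPowers

end

theorem mainTheorem1 {K : Type*} [Field K] {W : Type*} [Fintype W] [DecidableEq W]
    (U₁ U₂ V₁ V₂ : Finset W)
    (hU₁ : U₁.Nonempty) (hU₂ : U₂.Nonempty) (hV₁ : V₁.Nonempty) (hV₂ : V₂.Nonempty)
    (hU : Disjoint U₁ U₂) (hV : Disjoint V₁ V₂) (hUV : Disjoint (U₁ ∪ U₂) (V₁ ∪ V₂))
    (hW : (U₁ ∪ U₂) ∪ (V₁ ∪ V₂) = Finset.univ)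
    (G : SimpleGraph W)
    (hG : G = CoverIdealPowers.completeBipartiteOn U₁ (V₁ ∪ V₂) ⊔
      CoverIdealPowers.completeBipartiteOn U₂ V₂)
    (n₁ n₂ m₁ m₂ : ℤ)
    (hn₁ : n₁ = U₁.card) (hn₂ : n₂ = U₂.card) (hm₁ : m₁ = V₁.card) (hm₂ : m₂ = V₂.card)
    (s : ℕ) (hs : 1 ≤ s) :
    ((∃ F : CoverIdealPowers.GradedFreeResolution K W
          (CoverIdealPowers.quotientDeg (CoverIdealPowers.coverIdeal K G ^ s)), F.IsMinimal) ∧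
      ∀ F : CoverIdealPowers.GradedFreeResolution K W
          (CoverIdealPowers.quotientDeg (CoverIdealPowers.coverIdeal K G ^ s)), F.IsMinimal →
        F.rank 0 = 1 ∧ F.rank 1 = (s + 2).choose 2 ∧ F.rank 2 = 2 * (s + 1).choose 2 ∧
          F.rank 3 = s.choose 2 ∧ ∀ i, 4 ≤ i → F.rank i = 0) ∧
    ∃ r : ℤ,
      CoverIdealPowers.HasRegularity K W
        (CoverIdealPowers.idealDeg (CoverIdealPowers.coverIdeal K G ^ s)) r ∧
      IsGreatest
        ({q : ℤ | ∃ i j : ℕ, j ≤ i ∧ i ≤ s ∧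
            q = (s - j) * n₁ + (s - i) * n₂ + j * m₁ + i * m₂} ∪
          {q : ℤ | ∃ i j : ℕ, j < i ∧ i ≤ s ∧
            q = (s - j) * n₁ + (s - i) * n₂ + (j + 1) * m₁ + i * m₂ - 1} ∪
          {q : ℤ | ∃ i j : ℕ, j < i ∧ i ≤ s ∧
            q = (s - j) * n₁ + (s - i + 1) * n₂ + j * m₁ + i * m₂ - 1} ∪
          {q : ℤ | ∃ i j : ℕ, j < i ∧ i < s ∧
            q = (s - j) * n₁ + (s - i) * n₂ + (j + 1) * m₁ + (i + 1) * m₂ - 2}) r := by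
  have hUV11 : Disjoint U₁ V₁ :=
    hUV.mono Finset.subset_union_left Finset.subset_union_left
  have hUV12 : Disjoint U₁ V₂ :=
    hUV.mono Finset.subset_union_left Finset.subset_union_right
  have hUV22 : Disjoint U₂ V₂ :=
    hUV.mono Finset.subset_union_right Finset.subset_union_right
  have hR := CoverIdealPowers.isRegularQuadruple_prodX (K := K) hU hUV11 hUV12 hUV22
  have hdeg : ∀ (U : Finset W) (n : ℤ), n = U.card →
      CoverIdealPowers.prodX K U ∈ CoverIdealPowers.ringDeg K W n := by
    rintro U n rfl
    exact CoverIdealPowers.prodX_mem_ringDeg U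
  have hmin := CoverIdealPowers.cellMap_mem_irrelevant (K := K)
    (CoverIdealPowers.prodX_mem_irrelevant hU₁) (CoverIdealPowers.prodX_mem_irrelevant hU₂)
    (CoverIdealPowers.prodX_mem_irrelevant hV₁) (CoverIdealPowers.prodX_mem_irrelevant hV₂) hs
  have hI := CoverIdealPowers.span_pow_eq_span_vertexLabel (CoverIdealPowers.prodX K U₁)
    (CoverIdealPowers.prodX K U₂) (CoverIdealPowers.prodX K V₁) (CoverIdealPowers.prodX K V₂) s
  rw [← CoverIdealPowers.coverIdeal_eq_span hU hV hUV, ← hG] at hI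
  have hproj : ∀ d, ∀ p ∈ CoverIdealPowers.coverIdeal K G ^ s,
      CoverIdealPowers.ringProj d p ∈ CoverIdealPowers.coverIdeal K G ^ s := by
    rw [hI]
    refine fun d p => CoverIdealPowers.ringProj_mem_span ?_ d
    rintro _ ⟨i, j, hji, his, rfl⟩
    exact ⟨_, CoverIdealPowers.vertexLabel_mem_ringDeg (hdeg U₁ n₁ hn₁) (hdeg U₂ n₂ hn₂)
      (hdeg V₁ m₁ hm₁) (hdeg V₂ m₂ hm₂) his (hji.trans his)⟩
  refine ⟨?_, ?_⟩
  · obtain ⟨F, hF, hrank⟩ := CoverIdealPowers.exists_minimal_resolution_quotient hR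
      (hdeg U₁ n₁ hn₁) (hdeg U₂ n₂ hn₂) (hdeg V₁ m₁ hm₁) (hdeg V₂ m₂ hm₂) hmin hI
    refine ⟨⟨F, hF⟩, fun F' hF' => ?_⟩
    have h : ∀ i, F'.rank i = (CoverIdealPowers.cells s i).card := fun i =>
      (hF'.rank_eq (CoverIdealPowers.hasProjections_quotientDeg hproj) hF i).trans (hrank i)
    refine ⟨h 0, (h 1).trans (CoverIdealPowers.card_cells_one s),
      (h 2).trans (CoverIdealPowers.card_cells_two s),
      (h 3).trans (CoverIdealPowers.card_cells_three s), fun i hi => ?_⟩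
    obtain ⟨k, rfl⟩ := Nat.exists_eq_add_of_le' hi
    exact h (k + 4)
  · obtain ⟨F, hF, hshift⟩ := CoverIdealPowers.exists_minimal_resolution_ideal hR
      (hdeg U₁ n₁ hn₁) (hdeg U₂ n₂ hn₂) (hdeg V₁ m₁ hm₁) (hdeg V₂ m₂ hm₂) hmin hI
    obtain ⟨r, hr⟩ := CoverIdealPowers.exists_isGreatest_cellDeg n₁ n₂ m₁ m₂ s
    refine ⟨r, CoverIdealPowers.hasRegularity_of_shift_iff
      (CoverIdealPowers.hasProjections_idealDeg hproj) F hF hshift hr, ?_⟩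
    convert hr using 1
    ext q
    exact (CoverIdealPowers.exists_cellDeg_iff n₁ n₂ m₁ m₂ s q).symm
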